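/- Let $m,k\ge 0$ be integers, $n=2(k+m+2)+1$, and let $G=\mathrm{UT}(n,\mathbb R)$ be the group of real upper triangular $n\times n$ matrices with units on the diagonal, with its usual (Lie group) topology and Lie algebra $\mathfrak g$ of strictly upper triangular matrices. A strictly lower triangular matrix $f$ is identified with the linear form $x\mapsto\operatorname{tr}(fx)$ on $\mathfrak g$; $G^f$ is its stabilizer under the coadjoint action, and $\mathrm{Ad}_G(G^f)=\{hxh^{-1}: h\in G,\ x\in G^f\}$. Partition rows and columns into nine blocks of sizes $(m,1,1,k,1,k,1,1,m)$ and write $C_{ij}$ for the blocks of the general element $g\in G$. Let $f$ be the matrix whose only nonzero blocks are $f_{91}=\Lambda_1$, $f_{64}=\Lambda_2$, $f_{72}=\gamma_1$, $f_{83}=\gamma_2$, $f_{87}=\gamma_3$, where $\Lambda_1$ (of size $m$) and $\Lambda_2$ (of size $k$) have nonzero entries on the second diagonal (from the lower left to the upper right corner) and zeros elsewhere, $\gamma_1,\gamma_2\in\mathbb R\setminus\{0\}$ and $\gamma_3\in\mathbb R$. Let $\mathbb R'[G]$ be the localization of the algebra $\mathbb R[G]$ of regular functions on $G$ by the powers of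 $d_1(g)=\det C_{23}\cdot\det C_{46}\cdot\det C_{78}$, and $\Phi'=\{(2,3),(4,6),(7,8)\}$. For an entry $c$ of the block $C_{ij}$ let $\Phi'(c)$ be the set of all $(a,b)\in\Phi'$ with $a>i$ and $b<j$, let $\Delta(c)$ be the minor of $g$ whose rows are those of the row blocks $a$ and whose columns are those of the column blocks $b$, $(a,b)\in\Phi'(c)$ (an invertible element of $\mathbb R'[G]$), let $\tilde\Delta(c)$ be the minor obtained by adding the row and the column of $c$, and put $\tilde c=\pm\Delta(c)^{-1}\tilde\Delta(c)\in\mathbb R'[G]$, where $\pm$ is the sign of the entry $c$ in $\tilde\Delta(c)$. Let $S=S_0\cup S_1\cup S_2$, where 1) $S_0$ is the set of the entries above the diagonal in the blocks $C_{11},C_{44},C_{66},C_{99}$; 2) $S_1$ is the set of all $\tilde c$, where $c$ runs through the entries of the blocks $C_{12}$, $C_{14}$, $C_{15}$, $C_{17}$, $C_{34}$, $C_{35}$, $C_{37}$, $C_{39}$, $C_{45}$, $C_{56}$, $C_{57}$, $C_{59}$, $C_{67}$, $C_{69}$, $C_{89}$; 3) $S_2$ consists of the entries of $C_{23}C_{36}+C_{24}C_{46}$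 and of $C_{46}C_{68}+C_{47}C_{78}$, and of $\gamma_1C_{23}-\gamma_2C_{78}$. Let $I'$ be the ideal of $\mathbb R'[G]$ generated by $S$, and let $\mathrm{Ann}(I')$ be its zero set, that is, the set of all $g\in G$ with $d_1(g)\ne0$ at which all elements of $I'$ vanish. Then the closure of $\mathrm{Ann}(I')$ in $G$ coincides with the closure of $\mathrm{Ad}_G(G^f)$ in $G$. -/

import Mathlib

open scoped Matrix

noncomputable section

namespace Subregular

section General

variable (ι : Type) [Fintype ι] [LinearOrder ι]

/-- The real unitriangular group on a finite linearly ordered index set: upper triangular matrices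
with units on the diagonal. It carries the subspace topology of the space of matrices. -/
def UT : Subgroup (Matrix.SpecialLinearGroup ι ℝ) where
  carrier := {g | (∀ i, g.1 i i = 1) ∧ ∀ i j, j < i → g.1 i j = 0}
  mul_mem' := by
    rintro a b ⟨ha, ha'⟩ ⟨hb, hb'⟩
    refine ⟨fun i => ?_, fun i j hij => ?_⟩
    · rw [Matrix.SpecialLinearGroup.coe_mul, Matrix.mul_apply, Finset.sum_eq_single i]
      · rw [ha, hb, one_mul]
      · intro j _ hj
        rcases lt_or_gt_of_ne hj with h | h
        · rw [ha' i j h, zero_mul]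
        · rw [hb' j i h, mul_zero]
      · simp
    · rw [Matrix.SpecialLinearGroup.coe_mul, Matrix.mul_apply]
      refine Finset.sum_eq_zero fun l _ => ?_
      rcases lt_or_ge l i with h | h
      · rw [ha' i l h, zero_mul]
      · rw [hb' l j (lt_of_lt_of_le hij h), mul_zero]
  one_mem' := ⟨fun i => by simp, fun i j hij => by simp [hij.ne']⟩
  inv_mem' := by
    rintro a ⟨ha, ha'⟩
    have hmul : a.1 * (a⁻¹).1 = 1 := by
      rw [← Matrix.SpecialLinearGroup.coe_mul, mul_inv_cancel, Matrix.SpecialLinearGroup.coe_one]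
    have hinv : (a⁻¹).1 = a.1⁻¹ := (Matrix.inv_eq_right_inv hmul).symm
    have hlow : ∀ i j, j < i → (a⁻¹).1 i j = 0 := by
      intro i j hij
      let _ : Invertible a.1 := invertibleOfRightInverse _ _ hmul
      have hb : Matrix.BlockTriangular a.1 (id : ι → ι) := fun i j h => ha' i j h
      rw [hinv]
      exact Matrix.blockTriangular_inv_of_blockTriangular hb hij
    refine ⟨fun i => ?_, hlow⟩
    have h := congrFun (congrFun hmul i) i
    rw [Matrix.mul_apply, Finset.sum_eq_single i, ha, one_mul, Matrix.one_apply_eq] at h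
    · exact h
    · intro j _ hj
      rcases lt_or_gt_of_ne hj with h' | h'
      · rw [ha' i j h', zero_mul]
      · rw [hlow j i h', mul_zero]
    · simp

variable {ι}

/-- The underlying matrix of an element of the unitriangular group. -/
def mat (g : UT ι) : Matrix ι ι ℝ := g.1.1

variable (ι)

/-- The Lie algebra of the unitriangular group: strictly upper triangular matrices. -/
def ut : Submodule ℝ (Matrix ι ι ℝ) where
  carrier := {x | ∀ i j, j ≤ i → x i j = 0}
  add_mem' := fun {a b} ha hb i j h => by simp [ha i j h, hb i j h]
  zero_mem' := fun _ _ _ => rfl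
  smul_mem' := fun c a ha i j h => by simp [ha i j h]

variable {ι}

/-- The stabilizer `G^f` for the coadjoint action, where a strictly lower triangular matrix `f` is
identified with the linear form `x ↦ tr (f x)` on the Lie algebra, and the coadjoint action is
`(g • f) x = f (g⁻¹ x g)`. -/
def coadStabilizer (f : Matrix ι ι ℝ) : Set (UT ι) :=
  {g | ∀ x ∈ ut ι, Matrix.trace (f * (mat g⁻¹ * x * mat g)) = Matrix.trace (f * x)}

/-- `Ad_G (A)`: the union of the conjugates `h A h⁻¹` of a subset `A` of the group. -/
def conjSaturation (A : Set (UT ι)) : Set (UT ι) :=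
  {g | ∃ h : UT ι, ∃ x ∈ A, g = h * x * h⁻¹}

variable (ι)

/-- The algebra `ℝ[G]` of regular functions on the unitriangular group: as a variety the group is
the affine space whose coordinates are the matrix entries above the diagonal. -/
abbrev RegFun : Type := MvPolynomial {p : ι × ι // p.1 < p.2} ℝ

/-- The general element of the unitriangular group: the matrix of coordinate functions. -/
def genericMat : Matrix ι ι (RegFun ι) := fun i j =>
  if h : i < j then MvPolynomial.X ⟨(i, j), h⟩ else if i = j then 1 else 0

variable {ι}

/-- The value of regular functions at an element of the group. -/
def evalAt (g : UT ι) : RegFun ι →+* ℝ :=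
  (MvPolynomial.aeval fun p : {p : ι × ι // p.1 < p.2} => mat g p.1.1 p.1.2).toRingHom

/-- The zero set of an ideal `I` of the localization `ℝ[G]_d`: the set of those `g` in
`{g ∈ G | d g ≠ 0}` at which all elements of `I` vanish. -/
def zeroSet (d : RegFun ι) (I : Ideal (Localization.Away d)) : Set (UT ι) :=
  {g | ∃ hd : evalAt g d ≠ 0, ∀ φ ∈ I,
    IsLocalization.Away.lift (S := Localization.Away d) d (g := evalAt g) hd.isUnit φ = 0}

end General

section Odd

/-- The partition `(m, 1, 1, k, 1, k, 1, 1, m)` of `n = 2 (k + m + 2) + 1`. The nine blocks are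
numbered from `0` to `8`. -/
def size (m k : ℕ) : Fin 9 → ℕ := ![m, 1, 1, k, 1, k, 1, 1, m]

/-- The set of the `n = 2 (k + m + 2) + 1` row and column indices: pairs (block, place in the block)
in the lexicographic order. -/
abbrev Idx (m k : ℕ) : Type := Σₗ b : Fin 9, Fin (size m k b)

theorem card_Idx (m k : ℕ) : Fintype.card (Idx m k) = 2 * (k + m + 2) + 1 := by
  have h : Fintype.card (Idx m k) = ∑ b : Fin 9, size m k b := by
    rw [Fintype.card_lex, Fintype.card_sigma]
    exact Finset.sum_congr rfl fun b _ => Fintype.card_fin _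
  rw [h]
  simp [Fin.sum_univ_succ, size]
  ring

variable {m k : ℕ}

/-- The index at place `r` of block `b`. -/
def pos (b : Fin 9) (r : Fin (size m k b)) : Idx m k := toLex ⟨b, r⟩

/-- The matrix `f`, as a combination of matrix units. Its blocks `(8, 0)` and `(5, 3)` are the
matrices with second diagonal `l₁` resp. `l₂`, read from the lower left to the upper right corner,
and zeros elsewhere; the blocks `(6, 1)`, `(7, 2)`, `(7, 6)` are `γ₁`, `γ₂`, `γ₃`. -/
def fMat (l₁ : Fin m → ℝ) (l₂ : Fin k → ℝ) (γ₁ γ₂ γ₃ : ℝ) : Matrix (Idx m k) (Idx m k) ℝ :=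
  (∑ r : Fin m, Matrix.single (pos 8 (Fin.rev r)) (pos 0 r) (l₁ r)) +
  (∑ r : Fin k, Matrix.single (pos 5 (Fin.rev r)) (pos 3 r) (l₂ r)) +
  Matrix.single (pos 6 (0 : Fin 1)) (pos 1 (0 : Fin 1)) γ₁ +
  Matrix.single (pos 7 (0 : Fin 1)) (pos 2 (0 : Fin 1)) γ₂ +
  Matrix.single (pos 7 (0 : Fin 1)) (pos 6 (0 : Fin 1)) γ₃

variable (m k)

/-- The block in place `(a, b)` of the general element of the group. -/
def C (a b : Fin 9) : Matrix (Fin (size m k a)) (Fin (size m k b)) (RegFun (Idx m k)) :=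
  fun r q => genericMat (Idx m k) (pos a r) (pos b q)

/-- Row blocks of the three pairs `(1, 2), (3, 5), (6, 7)` of the set `Φ`. -/
def rowBlk : Fin 3 → Fin 9 := ![1, 3, 6]

/-- Column blocks of the three pairs `(1, 2), (3, 5), (6, 7)` of the set `Φ`. -/
def colBlk : Fin 3 → Fin 9 := ![2, 5, 7]

theorem size_rowBlk (s : Fin 3) : size m k (rowBlk s) = size m k (colBlk s) := by
  fin_cases s <;> rfl

/-- The square block of the general element in the place given by the `s`-th pair of `Φ`. -/
def pivot (s : Fin 3) :
    Matrix (Fin (size m k (rowBlk s))) (Fin (size m k (rowBlk s))) (RegFun (Idx m k)) :=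
  (C m k (rowBlk s) (colBlk s)).submatrix id (Fin.cast (size_rowBlk m k s))

/-- The function `d₁ = det C₁₂ · det C₃₅ · det C₆₇`. -/
def d₁ : RegFun (Idx m k) := (pivot m k 0).det * (pivot m k 1).det * (pivot m k 2).det

/-- The localization `ℝ'[G]` of `ℝ[G]` by the powers of `d₁`. -/
abbrev RegFun' : Type := Localization.Away (d₁ m k)

/-- For an entry in block `(i, j)`: the pairs `(a, b) ∈ Φ` with `a > i` and `b < j`. -/
abbrev PhiOf (i j : Fin 9) : Type := {s : Fin 3 // i < rowBlk s ∧ colBlk s < j}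

/-- Row (and column) numbers of the minor attached to an entry in block `(i, j)`. -/
abbrev MinorIdx (i j : Fin 9) : Type := Σ s : PhiOf i j, Fin (size m k (rowBlk s.1))

variable {m k}

/-- The index of the row with a given number. -/
def minorRow {i j : Fin 9} (x : MinorIdx m k i j) : Idx m k := pos (rowBlk x.1.1) x.2

/-- The index of the column with a given number. -/
def minorCol {i j : Fin 9} (x : MinorIdx m k i j) : Idx m k :=
  pos (colBlk x.1.1) (Fin.cast (size_rowBlk m k x.1.1) x.2)

variable (m k)

/-- `Δ(c)` for an entry `c` in block `(i, j)`: the minor of the general element on the rows of the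
blocks `a` and the columns of the blocks `b`, for `(a, b)` in `Φ(c)`. -/
def Δ (i j : Fin 9) : RegFun (Idx m k) :=
  ((genericMat (Idx m k)).submatrix (minorRow (i := i) (j := j)) minorCol).det

/-- The minor obtained from `Δ(c)` by adding the row and the column of the entry `c` in place
`(r, q)` of block `(i, j)`. The new row and the new column are written last, so that `c` has the
sign `+` in it; in the increasing order of the rows, the row of `c` is the first one, which
multiplies both the minor and the sign of `c` in it by the same power of `-1`. -/
def ΔTilde (i j : Fin 9) (r : Fin (size m k i)) (q : Fin (size m k j)) : RegFun (Idx m k) :=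
  ((genericMat (Idx m k)).submatrix
    (Sum.elim (minorRow (i := i) (j := j)) fun _ : Unit => pos i r)
    (Sum.elim (minorCol (i := i) (j := j)) fun _ : Unit => pos j q)).det

theorem genericMat_eq_zero {p q : Idx m k} (h : q < p) : genericMat (Idx m k) p q = 0 := by
  simp [genericMat, h.ne', not_lt.2 h.le]

theorem Δ_eq_prod (i j : Fin 9) : Δ m k i j = ∏ s : PhiOf i j, (pivot m k s.1).det := by
  have hlt : ∀ s t : Fin 3, t < s → colBlk t < rowBlk s := by decide
  have hb : Matrix.BlockTriangular
      ((genericMat (Idx m k)).submatrix (minorRow (i := i) (j := j)) minorCol) Sigma.fst := by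
    intro x y hxy
    exact genericMat_eq_zero m k (Sigma.Lex.lt_def.2 (Or.inl (hlt _ _ hxy)))
  rw [Δ, hb.det_fintype]
  refine Finset.prod_congr rfl fun s _ => ?_
  let e : Fin (size m k (rowBlk s.1)) ≃ {x : MinorIdx m k i j // x.1 = s} :=
    { toFun := fun r => ⟨⟨s, r⟩, rfl⟩
      invFun := fun x => Fin.cast (by rw [x.2]) x.1.2
      left_inv := fun r => rfl
      right_inv := by rintro ⟨⟨t, r⟩, rfl⟩; rfl }
  rw [← Matrix.det_submatrix_equiv_self e]
  rfl

/-- The minors `Δ(c)` are invertible in the localization, so that `Δ(c)⁻¹` makes sense there. -/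
theorem isUnit_Δ (i j : Fin 9) : IsUnit (algebraMap _ (RegFun' m k) (Δ m k i j)) := by
  have h : IsUnit (algebraMap _ (RegFun' m k)
      ((pivot m k 0).det * (pivot m k 1).det * (pivot m k 2).det)) :=
    IsLocalization.Away.algebraMap_isUnit (d₁ m k)
  have hs : ∀ s, IsUnit (algebraMap _ (RegFun' m k) (pivot m k s).det) := by
    rw [map_mul, map_mul, IsUnit.mul_iff, IsUnit.mul_iff] at h
    intro s
    fin_cases s
    exacts [h.1.1, h.1.2, h.2]
  rw [Δ_eq_prod, map_prod, IsUnit.prod_univ_iff]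
  exact fun s => hs s.1

/-- The function `c̃ = ± Δ(c)⁻¹ Δ̃(c)` in `ℝ'[G]`, for the entry `c` in place `(r, q)` of block
`(i, j)`. -/
def cTilde (i j : Fin 9) (r : Fin (size m k i)) (q : Fin (size m k j)) : RegFun' m k :=
  ((isUnit_Δ m k i j).unit⁻¹ : (RegFun' m k)ˣ) * algebraMap _ (RegFun' m k) (ΔTilde m k i j r q)

/-- The blocks marked by a bullet. -/
def bullets : Set (Fin 9 × Fin 9) :=
  {(0, 1), (0, 3), (0, 4), (0, 6), (2, 3), (2, 4), (2, 6), (2, 8), (3, 4), (4, 5), (4, 6), (4, 8),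
    (5, 6), (5, 8), (7, 8)}

/-- The entries above the diagonal in the diagonal blocks of sizes `m, k, k, m`. -/
def S₀ : Set (RegFun (Idx m k)) :=
  {φ | ∃ b ∈ ({0, 3, 5, 8} : Set (Fin 9)), ∃ r q : Fin (size m k b), r < q ∧ φ = C m k b b r q}

/-- The functions `c̃` for the entries `c` of the marked blocks. -/
def S₁ : Set (RegFun' m k) :=
  {φ | ∃ i j : Fin 9, (i, j) ∈ bullets ∧ ∃ r q, φ = cTilde m k i j r q}

/-- The entries of `C₁₂ C₂₅ + C₁₃ C₃₅` and `C₃₅ C₅₇ + C₃₆ C₆₇`, and `γ₁ C₁₂ - γ₂ C₆₇`. -/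
def S₂ (γ₁ γ₂ : ℝ) : Set (RegFun (Idx m k)) :=
  {φ | ∃ r q, φ = (C m k 1 2 * C m k 2 5 + C m k 1 3 * C m k 3 5) r q} ∪
  {φ | ∃ r q, φ = (C m k 3 5 * C m k 5 7 + C m k 3 6 * C m k 6 7) r q} ∪
  {MvPolynomial.C γ₁ * C m k 1 2 (0 : Fin 1) (0 : Fin 1) -
    MvPolynomial.C γ₂ * C m k 6 7 (0 : Fin 1) (0 : Fin 1)}

/-- The system `S = S₀ ∪ S₁ ∪ S₂` in `ℝ'[G]`. -/
def S (γ₁ γ₂ : ℝ) : Set (RegFun' m k) :=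
  algebraMap (RegFun (Idx m k)) (RegFun' m k) '' S₀ m k ∪ S₁ m k ∪
    algebraMap (RegFun (Idx m k)) (RegFun' m k) '' S₂ m k γ₁ γ₂

/-- The ideal `I'` of `ℝ'[G]` generated by `S`. -/
def I' (γ₁ γ₂ : ℝ) : Ideal (RegFun' m k) := Ideal.span (S m k γ₁ γ₂)

end Odd

end Subregular

end

noncomputable section

namespace Subregular

/-! ### The unitriangular group and the stabilizer condition. -/

section UnitriangularGroup

variable {ι : Type} [Fintype ι] [LinearOrder ι]

/-! Everything is computed with the nilpotent matrix `g - 1`, on which conjugation acts linearly;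
blocks are numbered from 0 to 8. A group element fixes the form `f` exactly when `g f - f g` is
upper triangular. Comparing blocks (`mem_coadStabilizer_fMat_iff`), this says that `g - 1` lives in
the blocks `stabBlocks`, that its blocks (0,8) and (3,5) have entries on the second diagonal only,
and that the scalars in (1,2) and (6,7) are tied by one linear relation.

Conjugates of the stabilizer lie in the closure of the zero set. Multiplying on both sides by upper
triangular matrices mixes the entries of a lower left corner only among themselves, so vanishing and
rank bounds of such corners survive conjugation. The rank bounds kill the bordered minors, the
vanishing corners of `g - 1` give `S₀`, and corners of `(g - 1)²` give the quadratic equations of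
`S₂`. The linear equation of `S₂` survives because each pivot block is alone in its corner. All this
is `conj_stab_mem_zeroSet`. The condition `d₁ ≠ 0` is reached by a small perturbation inside the
stabilizer (`conj_stab_mem_closure_zeroSet`).

Zeros lie in the closure of the conjugates. Where `d₁ ≠ 0`, the vanishing of a bordered minor is the
vanishing of a Schur complement: it expresses a marked block through the pivot columns
(`bullet_relation`). These relations allow one to write down a unitriangular `h` that brings `g - 1`
to the form `stabMat`, with nonzero blocks at most in (1,2), (6,7), (1,6), (3,5), (0,8)
(`exists_intertwining`, `exists_conj_of_mem_zeroSet`). Such a matrix can differ from a stabilizer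
element only in that the square blocks `A` in (3,5) and `T` in (0,8) are arbitrary. Block diagonal
conjugation acts on them by independent unitriangular row and column operations, which make a
generic square matrix antidiagonal. The matrices for which this works form a dense set
(`dense_bigCell`), and the closure absorbs the rest (`conj_stabMat_mem_closure`). -/

theorem mat_mul (g h : UT ι) : mat (g * h) = mat g * mat h := rfl

theorem mat_one : mat (1 : UT ι) = 1 := rfl

theorem mat_mul_mat_inv (g : UT ι) : mat g * mat g⁻¹ = 1 := by
  rw [← mat_mul, mul_inv_cancel, mat_one]

theorem mat_inv_mul_mat (g : UT ι) : mat g⁻¹ * mat g = 1 := by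
  rw [← mat_mul, inv_mul_cancel, mat_one]

theorem mat_diag (g : UT ι) (i : ι) : mat g i i = 1 := g.2.1 i

theorem mat_lower (g : UT ι) {i j : ι} (h : j < i) : mat g i j = 0 := g.2.2 i j h

theorem mat_injective : Function.Injective (mat : UT ι → Matrix ι ι ℝ) := fun _ _ h =>
  Subtype.ext (Subtype.ext h)

/-- The element of the unitriangular group with a given unitriangular matrix. -/
def ofMat (M : Matrix ι ι ℝ) (h₁ : ∀ i, M i i = 1) (h₀ : ∀ i j, j < i → M i j = 0) : UT ι :=
  ⟨⟨M, by
    rw [Matrix.det_of_isUpperTriangular (fun i j h => h₀ i j h)]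
    exact Finset.prod_eq_one fun i _ => h₁ i⟩, h₁, h₀⟩

/-- The unitriangular matrix `1 + x`, for a strictly upper triangular matrix `x`. -/
def oneAdd (x : Matrix ι ι ℝ) (hx : ∀ p q, q ≤ p → x p q = 0) : UT ι :=
  ofMat (1 + x)
    (fun i => by rw [Matrix.add_apply, hx i i le_rfl, Matrix.one_apply_eq, add_zero])
    (fun i j h => by
      rw [Matrix.add_apply, hx i j h.le, Matrix.one_apply_ne h.ne', add_zero])

theorem mat_oneAdd (x : Matrix ι ι ℝ) (hx : ∀ p q, q ≤ p → x p q = 0) :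
    mat (oneAdd x hx) = 1 + x := rfl

theorem mat_oneAdd_sub_one (x : Matrix ι ι ℝ) (hx : ∀ p q, q ≤ p → x p q = 0) :
    mat (oneAdd x hx) - 1 = x := by
  rw [mat_oneAdd, add_sub_cancel_left]

theorem oneAdd_eq {g : UT ι} {x : Matrix ι ι ℝ} (hx : ∀ p q, q ≤ p → x p q = 0)
    (h : x = mat g - 1) : oneAdd x hx = g :=
  mat_injective (by rw [mat_oneAdd, h, add_sub_cancel])

theorem isInducing_mat : Topology.IsInducing (mat : UT ι → Matrix ι ι ℝ) :=
  Topology.IsInducing.subtypeVal.comp Topology.IsInducing.subtypeVal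

theorem eq_conj_of_mat_mul {g h x : UT ι} (H : mat g * mat h = mat h * mat x) :
    g = h * x * h⁻¹ := by
  rw [eq_mul_inv_iff_mul_eq]
  exact mat_injective H

theorem mat_conj_sub_one (h x : UT ι) :
    mat (h * x * h⁻¹) - 1 = mat h * (mat x - 1) * mat h⁻¹ := by
  rw [mul_sub, sub_mul, mat_mul, mat_mul, mul_one, mat_mul_mat_inv]

theorem conj_mul_conj (h : UT ι) (X Y : Matrix ι ι ℝ) :
    mat h * X * mat h⁻¹ * (mat h * Y * mat h⁻¹) = mat h * (X * Y) * mat h⁻¹ := by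
  calc _ = mat h * X * (mat h⁻¹ * mat h) * Y * mat h⁻¹ := by simp only [mul_assoc]
    _ = _ := by rw [mat_inv_mul_mat, mul_one]; simp only [mul_assoc]

/-- A matrix is upper triangular: all entries below the diagonal vanish. -/
def IsUpper (M : Matrix ι ι ℝ) : Prop := ∀ i j, j < i → M i j = 0

theorem IsUpper.mul {M N : Matrix ι ι ℝ} (hM : IsUpper M) (hN : IsUpper N) : IsUpper (M * N) := by
  intro i j hij
  rw [Matrix.mul_apply]
  refine Finset.sum_eq_zero fun l _ => ?_
  rcases lt_or_ge l i with h | h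
  · rw [hM i l h, zero_mul]
  · rw [hN l j (lt_of_lt_of_le hij h), mul_zero]

theorem isUpper_mat (g : UT ι) : IsUpper (mat g) := fun _ _ h => mat_lower g h

/-- The stabilizer of a linear form consists of the `g` for which `g f - f g` is upper
triangular. -/
theorem mem_coadStabilizer_iff (f : Matrix ι ι ℝ) (g : UT ι) :
    g ∈ coadStabilizer f ↔ IsUpper (mat g * f - f * mat g) := by
  have key : ∀ x, Matrix.trace (f * (mat g⁻¹ * x * mat g)) - Matrix.trace (f * x) =
      Matrix.trace ((mat g * f * mat g⁻¹ - f) * x) := by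
    intro x
    rw [sub_mul, Matrix.trace_sub]
    congr 1
    rw [← mul_assoc, Matrix.trace_mul_comm]
    simp only [mul_assoc]
  have e₁ : (mat g * f - f * mat g) * mat g⁻¹ = mat g * f * mat g⁻¹ - f := by
    rw [sub_mul, mul_assoc f, mat_mul_mat_inv, mul_one]
  have e₂ : (mat g * f * mat g⁻¹ - f) * mat g = mat g * f - f * mat g := by
    rw [sub_mul, mul_assoc _ (mat g⁻¹), mat_inv_mul_mat, mul_one]
  constructor
  · intro h
    rw [← e₂]
    refine IsUpper.mul ?_ (isUpper_mat g)
    intro i j hij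
    -- For `j < i`, testing on this matrix unit reads off the entry `(i, j)` of `g f g⁻¹ - f`. Right
    -- multiplication by `g` preserves upper triangularity and turns that matrix into `g f - f g`.
    have hx : Matrix.single j i (1 : ℝ) ∈ ut ι := by
      intro a b hab
      refine Matrix.single_apply_of_ne _ _ _ _ _ ?_
      rintro ⟨rfl, rfl⟩
      exact absurd hij (not_lt.2 hab)
    have h' := key (Matrix.single j i 1)
    rw [h _ hx, sub_self, Matrix.trace_mul_single] at h'
    simpa using h'.symm
  · intro h x hx
    rw [← sub_eq_zero, key, ← e₁]
    have hu := h.mul (isUpper_mat g⁻¹)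
    rw [Matrix.trace]
    refine Finset.sum_eq_zero fun i _ => ?_
    rw [Matrix.diag_apply, Matrix.mul_apply]
    refine Finset.sum_eq_zero fun j _ => ?_
    rcases lt_or_ge j i with hj | hj
    · rw [hu i j hj, zero_mul]
    · rw [hx j i hj, mul_zero]

theorem evalAt_genericMat (g : UT ι) (i j : ι) : evalAt g (genericMat ι i j) = mat g i j := by
  unfold genericMat
  split_ifs with h h'
  · simp [evalAt]
  · rw [map_one, h', mat_diag]
  · rw [map_zero, mat_lower g (lt_of_le_of_ne (not_lt.1 h) (Ne.symm h'))]

theorem evalAt_C (g : UT ι) (c : ℝ) : evalAt g (MvPolynomial.C c) = c := by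
  simp [evalAt]

end UnitriangularGroup

/-! ### Block decomposition and evaluation of the equations at a group element. -/

section Blocks

variable {m k : ℕ}

/-- The block containing an index. -/
def blkOf (p : Idx m k) : Fin 9 := (ofLex p).1

theorem pos_surj (p : Idx m k) : ∃ r, p = pos (blkOf p) r := ⟨(ofLex p).2, rfl⟩

theorem pos_injective (b : Fin 9) : Function.Injective (pos b : Fin (size m k b) → Idx m k) := by
  intro r q h
  have h' : (⟨b, r⟩ : Σ b : Fin 9, Fin (size m k b)) = ⟨b, q⟩ := h
  simpa using h'

theorem blkOf_mono {p q : Idx m k} (h : p ≤ q) : blkOf p ≤ blkOf q := by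
  rcases Sigma.Lex.le_def.1 h with h | ⟨h, _⟩
  · exact h.le
  · exact h.le

theorem lt_of_blkOf_lt {p q : Idx m k} (h : blkOf p < blkOf q) : p < q :=
  Sigma.Lex.lt_def.2 (Or.inl h)

theorem pos_lt_pos {b : Fin 9} {r q : Fin (size m k b)} :
    (pos b r : Idx m k) < pos b q ↔ r < q := by
  constructor
  · intro h
    rcases Sigma.Lex.lt_def.1 h with h | ⟨_, h⟩
    · exact absurd h (lt_irrefl _)
    · exact h
  · exact fun h => Sigma.Lex.lt_def.2 (Or.inr ⟨rfl, h⟩)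

/-- The block of a matrix in place `(a, b)`. -/
def blk (M : Matrix (Idx m k) (Idx m k) ℝ) (a b : Fin 9) :
    Matrix (Fin (size m k a)) (Fin (size m k b)) ℝ := M.submatrix (pos a) (pos b)

theorem blk_apply (M : Matrix (Idx m k) (Idx m k) ℝ) (a b : Fin 9) (r : Fin (size m k a))
    (q : Fin (size m k b)) : blk M a b r q = M (pos a r) (pos b q) := rfl

theorem sum_idx (F : Idx m k → ℝ) : ∑ p, F p = ∑ b, ∑ r, F (pos b r) :=
  Fintype.sum_sigma (fun x : Σ b : Fin 9, Fin (size m k b) => F (toLex x))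

theorem blk_mul (M N : Matrix (Idx m k) (Idx m k) ℝ) (a b : Fin 9) :
    blk (M * N) a b = ∑ c, blk M a c * blk N c b := by
  ext r q
  rw [blk_apply, Matrix.mul_apply, sum_idx, Matrix.sum_apply]
  rfl

theorem sum_fin_nine {M : Type} [AddCommMonoid M] (f : Fin 9 → M) :
    ∑ c, f c = f 0 + f 1 + f 2 + f 3 + f 4 + f 5 + f 6 + f 7 + f 8 := by
  rw [Fin.sum_univ_castSucc, Fin.sum_univ_eight]
  rfl

theorem evalAt_block (g : UT (Idx m k)) (a b : Fin 9) (r : Fin (size m k a))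
    (q : Fin (size m k b)) : evalAt g (C m k a b r q) = mat g (pos a r) (pos b q) :=
  evalAt_genericMat g _ _

theorem evalAt_block_mul (g : UT (Idx m k)) (a b c : Fin 9) (r : Fin (size m k a))
    (q : Fin (size m k c)) : evalAt g ((C m k a b * C m k b c) r q) =
      (blk (mat g) a b * blk (mat g) b c) r q := by
  simp only [Matrix.mul_apply, map_sum, map_mul, evalAt_block, blk_apply]

theorem evalAt_pivot_det (g : UT (Idx m k)) (s : Fin 3) : evalAt g (pivot m k s).det =
    ((blk (mat g) (rowBlk s) (colBlk s)).submatrix id (Fin.cast (size_rowBlk m k s))).det := by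
  rw [RingHom.map_det]
  congr 1
  ext r q
  exact evalAt_block g _ _ _ _

theorem evalAt_d₁_ne_zero_iff (g : UT (Idx m k)) : evalAt g (d₁ m k) ≠ 0 ↔
    ∀ s, ((blk (mat g) (rowBlk s) (colBlk s)).submatrix id
      (Fin.cast (size_rowBlk m k s))).det ≠ 0 := by
  simp only [← evalAt_pivot_det, Fin.forall_fin_succ, IsEmpty.forall_iff]
  simp [d₁, and_assoc]

theorem evalAt_ΔTilde (g : UT (Idx m k)) (i j : Fin 9) (r : Fin (size m k i))
    (q : Fin (size m k j)) : evalAt g (ΔTilde m k i j r q) =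
      ((mat g).submatrix (Sum.elim (minorRow (i := i) (j := j)) fun _ : Unit => pos i r)
        (Sum.elim (minorCol (i := i) (j := j)) fun _ : Unit => pos j q)).det := by
  rw [ΔTilde, RingHom.map_det]
  congr 1
  ext r q
  exact evalAt_genericMat g _ _

theorem evalAt_Δ (g : UT (Idx m k)) (i j : Fin 9) : evalAt g (Δ m k i j) =
      ((mat g).submatrix (minorRow (i := i) (j := j)) minorCol).det := by
  rw [Δ, RingHom.map_det]
  congr 1
  ext r q
  exact evalAt_genericMat g _ _

/-- This removes the localization: the kernel of evaluation is an ideal, so generators suffice, and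
the factor `Δ(c)⁻¹` of `c̃` is a unit, so only the polynomial minor `ΔTilde` matters. -/
theorem mem_zeroSet_iff (γ₁ γ₂ : ℝ) (g : UT (Idx m k)) :
    g ∈ zeroSet (d₁ m k) (I' m k γ₁ γ₂) ↔ evalAt g (d₁ m k) ≠ 0 ∧
      (∀ φ ∈ S₀ m k, evalAt g φ = 0) ∧
      (∀ i j, (i, j) ∈ bullets → ∀ r q, evalAt g (ΔTilde m k i j r q) = 0) ∧
      ∀ φ ∈ S₂ m k γ₁ γ₂, evalAt g φ = 0 := by
  have key : ∀ hd : evalAt g (d₁ m k) ≠ 0, ((∀ φ ∈ I' m k γ₁ γ₂,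
      IsLocalization.Away.lift (S := RegFun' m k) (d₁ m k) (g := evalAt g) hd.isUnit φ = 0) ↔
      (∀ φ ∈ S₀ m k, evalAt g φ = 0) ∧
      (∀ i j, (i, j) ∈ bullets → ∀ r q, evalAt g (ΔTilde m k i j r q) = 0) ∧
      ∀ φ ∈ S₂ m k γ₁ γ₂, evalAt g φ = 0) := by
    intro hd
    set L := IsLocalization.Away.lift (S := RegFun' m k) (d₁ m k) (g := evalAt g) hd.isUnit with hL
    have hLa : ∀ φ, L (algebraMap _ _ φ) = evalAt g φ := fun φ =>
      IsLocalization.Away.lift_eq _ _ _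
    have h₁ : (∀ φ ∈ I' m k γ₁ γ₂, L φ = 0) ↔ ∀ φ ∈ S m k γ₁ γ₂, L φ = 0 := by
      constructor
      · exact fun h φ hφ => h φ (Ideal.subset_span hφ)
      · intro h φ hφ
        have : I' m k γ₁ γ₂ ≤ RingHom.ker L := Ideal.span_le.2 fun ψ hψ => h ψ hψ
        exact this hφ
    have h₂ : ∀ i j r q, L (cTilde m k i j r q) = 0 ↔ evalAt g (ΔTilde m k i j r q) = 0 := by
      intro i j r q
      rw [cTilde, map_mul, hLa]
      have : IsUnit (L (((isUnit_Δ m k i j).unit⁻¹ : (RegFun' m k)ˣ) : RegFun' m k)) :=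
        (Units.isUnit _).map L
      rw [mul_eq_zero, or_iff_right this.ne_zero]
    rw [h₁]
    simp only [S, Set.mem_union, or_imp, forall_and, Set.forall_mem_image, hLa, and_assoc]
    refine and_congr Iff.rfl (and_congr ?_ Iff.rfl)
    constructor
    · intro h i j hij r q
      exact (h₂ i j r q).1 (h _ ⟨i, j, hij, r, q, rfl⟩)
    · rintro h _ ⟨i, j, hij, r, q, rfl⟩
      exact (h₂ i j r q).2 (h i j hij r q)
  constructor
  · rintro ⟨hd, h⟩
    exact ⟨hd, (key hd).1 h⟩
  · rintro ⟨hd, h⟩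
    exact ⟨hd, (key hd).2 h⟩

end Blocks

/-! ### Explicit names for the indices of the nine blocks. -/

section Indices

variable {m k : ℕ}

/-- The index of a place in block `0`, the place having a literal type; likewise below. -/
def idx0 (r : Fin m) : Idx m k := pos 0 r
def idx1 : Idx m k := pos 1 (0 : Fin 1)
def idx2 : Idx m k := pos 2 (0 : Fin 1)
def idx3 (r : Fin k) : Idx m k := pos 3 r
def idx4 : Idx m k := pos 4 (0 : Fin 1)
def idx5 (r : Fin k) : Idx m k := pos 5 r
def idx6 : Idx m k := pos 6 (0 : Fin 1)
def idx7 : Idx m k := pos 7 (0 : Fin 1)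
def idx8 (r : Fin m) : Idx m k := pos 8 r

@[simp] theorem blkOf_idx0 (r : Fin m) : blkOf (idx0 r : Idx m k) = 0 := rfl
@[simp] theorem blkOf_idx1 : blkOf (idx1 : Idx m k) = 1 := rfl
@[simp] theorem blkOf_idx2 : blkOf (idx2 : Idx m k) = 2 := rfl
@[simp] theorem blkOf_idx3 (r : Fin k) : blkOf (idx3 r : Idx m k) = 3 := rfl
@[simp] theorem blkOf_idx4 : blkOf (idx4 : Idx m k) = 4 := rfl
@[simp] theorem blkOf_idx5 (r : Fin k) : blkOf (idx5 r : Idx m k) = 5 := rfl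
@[simp] theorem blkOf_idx6 : blkOf (idx6 : Idx m k) = 6 := rfl
@[simp] theorem blkOf_idx7 : blkOf (idx7 : Idx m k) = 7 := rfl
@[simp] theorem blkOf_idx8 (r : Fin m) : blkOf (idx8 r : Idx m k) = 8 := rfl

@[simp] theorem idx0_inj {r q : Fin m} : (idx0 r : Idx m k) = idx0 q ↔ r = q :=
  (pos_injective 0).eq_iff
@[simp] theorem idx3_inj {r q : Fin k} : (idx3 r : Idx m k) = idx3 q ↔ r = q :=
  (pos_injective 3).eq_iff
@[simp] theorem idx5_inj {r q : Fin k} : (idx5 r : Idx m k) = idx5 q ↔ r = q :=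
  (pos_injective 5).eq_iff
@[simp] theorem idx8_inj {r q : Fin m} : (idx8 r : Idx m k) = idx8 q ↔ r = q :=
  (pos_injective 8).eq_iff

theorem idx0_lt {r q : Fin m} : (idx0 r : Idx m k) < idx0 q ↔ r < q := pos_lt_pos
theorem idx3_lt {r q : Fin k} : (idx3 r : Idx m k) < idx3 q ↔ r < q := pos_lt_pos
theorem idx5_lt {r q : Fin k} : (idx5 r : Idx m k) < idx5 q ↔ r < q := pos_lt_pos
theorem idx8_lt {r q : Fin m} : (idx8 r : Idx m k) < idx8 q ↔ r < q := pos_lt_pos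

theorem idx_cases (p : Idx m k) : (∃ r, p = idx0 r) ∨ p = idx1 ∨ p = idx2 ∨ (∃ r, p = idx3 r) ∨
    p = idx4 ∨ (∃ r, p = idx5 r) ∨ p = idx6 ∨ p = idx7 ∨ ∃ r, p = idx8 r := by
  obtain ⟨b, r, rfl⟩ : ∃ b r, p = pos b r := ⟨_, pos_surj p⟩
  have h1 : ∀ r : Fin 1, r = 0 := fun r => Subsingleton.elim _ _
  fin_cases b
  · exact Or.inl ⟨r, rfl⟩
  · exact .inr <| .inl <| congrArg (fun r : Fin 1 => (pos 1 r : Idx m k)) (h1 r)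
  · exact .inr <| .inr <| .inl <| congrArg (fun r : Fin 1 => (pos 2 r : Idx m k)) (h1 r)
  · exact .inr <| .inr <| .inr <| .inl ⟨r, rfl⟩
  · exact .inr <| .inr <| .inr <| .inr <| .inl <|
      congrArg (fun r : Fin 1 => (pos 4 r : Idx m k)) (h1 r)
  · exact .inr <| .inr <| .inr <| .inr <| .inr <| .inl ⟨r, rfl⟩
  · exact .inr <| .inr <| .inr <| .inr <| .inr <| .inr <| .inl <|
      congrArg (fun r : Fin 1 => (pos 6 r : Idx m k)) (h1 r)
  · exact .inr <| .inr <| .inr <| .inr <| .inr <| .inr <| .inr <| .inl <|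
      congrArg (fun r : Fin 1 => (pos 7 r : Idx m k)) (h1 r)
  · exact .inr <| .inr <| .inr <| .inr <| .inr <| .inr <| .inr <| .inr ⟨r, rfl⟩

theorem ne_of_blkOf_ne {p q : Idx m k} (h : blkOf p ≠ blkOf q) : p ≠ q :=
  fun h' => h (congrArg blkOf h')

/-- The Boolean hypothesis lets the comparison of block numbers be settled by evaluation; the same
device is used for the vanishing statements below. -/
theorem not_eq_of_blkOf (p q : Idx m k) (h : decide (blkOf p = blkOf q) = false) : ¬ p = q :=
  ne_of_blkOf_ne (of_decide_eq_false h)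

end Indices

/-! ### Left and right multiplication by the matrix of the form. -/

section FormMultiplication

theorem mul_single_apply {ι : Type} [Fintype ι] [DecidableEq ι] (M : Matrix ι ι ℝ) (i j : ι)
    (c : ℝ) (p q : ι) : (M * Matrix.single i j c) p q = if j = q then M p i * c else 0 := by
  split_ifs with h
  · subst h; simp
  · exact Matrix.mul_single_apply_of_ne (hbj := Ne.symm h) ..

theorem single_mul_apply {ι : Type} [Fintype ι] [DecidableEq ι] (M : Matrix ι ι ℝ) (i j : ι)
    (c : ℝ) (p q : ι) : (Matrix.single i j c * M) p q = if i = p then c * M j q else 0 := by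
  split_ifs with h
  · subst h; simp
  · exact Matrix.single_mul_apply_of_ne (h := Ne.symm h) ..

variable {m k : ℕ} (l₁ : Fin m → ℝ) (l₂ : Fin k → ℝ) (γ₁ γ₂ γ₃ : ℝ)

theorem fMat_eq : fMat l₁ l₂ γ₁ γ₂ γ₃ =
    (∑ r : Fin m, Matrix.single (idx8 (Fin.rev r)) (idx0 r) (l₁ r)) +
    (∑ r : Fin k, Matrix.single (idx5 (Fin.rev r)) (idx3 r) (l₂ r)) +
    Matrix.single idx6 idx1 γ₁ + Matrix.single idx7 idx2 γ₂ + Matrix.single idx7 idx6 γ₃ := rfl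

theorem mul_fMat_apply (M : Matrix (Idx m k) (Idx m k) ℝ) (p q : Idx m k) :
    (M * fMat l₁ l₂ γ₁ γ₂ γ₃) p q =
      (∑ r : Fin m, if idx0 r = q then M p (idx8 (Fin.rev r)) * l₁ r else 0) +
      (∑ r : Fin k, if idx3 r = q then M p (idx5 (Fin.rev r)) * l₂ r else 0) +
      (if idx1 = q then M p idx6 * γ₁ else 0) + (if idx2 = q then M p idx7 * γ₂ else 0) +
      (if idx6 = q then M p idx7 * γ₃ else 0) := by
  simp only [fMat_eq, mul_add, Matrix.mul_sum, Matrix.add_apply, Matrix.sum_apply,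
    mul_single_apply]

theorem fMat_mul_apply (M : Matrix (Idx m k) (Idx m k) ℝ) (p q : Idx m k) :
    (fMat l₁ l₂ γ₁ γ₂ γ₃ * M) p q =
      (∑ r : Fin m, if idx8 r = p then l₁ (Fin.rev r) * M (idx0 (Fin.rev r)) q else 0) +
      (∑ r : Fin k, if idx5 r = p then l₂ (Fin.rev r) * M (idx3 (Fin.rev r)) q else 0) +
      (if idx6 = p then γ₁ * M idx1 q else 0) + (if idx7 = p then γ₂ * M idx2 q else 0) +
      (if idx7 = p then γ₃ * M idx6 q else 0) := by
  simp only [fMat_eq, add_mul, Matrix.sum_mul, Matrix.add_apply, Matrix.sum_apply,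
    single_mul_apply]
  congr 4
  · refine Fintype.sum_equiv Fin.revPerm _ _ fun r => ?_
    simp
  · refine Fintype.sum_equiv Fin.revPerm _ _ fun r => ?_
    simp

variable (M : Matrix (Idx m k) (Idx m k) ℝ) (p q : Idx m k)

@[simp] theorem mul_fMat_idx0 (r : Fin m) :
    (M * fMat l₁ l₂ γ₁ γ₂ γ₃) p (idx0 r) = M p (idx8 (Fin.rev r)) * l₁ r := by
  simp [mul_fMat_apply, not_eq_of_blkOf]

@[simp] theorem mul_fMat_idx1 :
    (M * fMat l₁ l₂ γ₁ γ₂ γ₃) p idx1 = M p idx6 * γ₁ := by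
  simp [mul_fMat_apply, not_eq_of_blkOf]

@[simp] theorem mul_fMat_idx2 :
    (M * fMat l₁ l₂ γ₁ γ₂ γ₃) p idx2 = M p idx7 * γ₂ := by
  simp [mul_fMat_apply, not_eq_of_blkOf]

@[simp] theorem mul_fMat_idx3 (r : Fin k) :
    (M * fMat l₁ l₂ γ₁ γ₂ γ₃) p (idx3 r) = M p (idx5 (Fin.rev r)) * l₂ r := by
  simp [mul_fMat_apply, not_eq_of_blkOf]

@[simp] theorem mul_fMat_idx4 :
    (M * fMat l₁ l₂ γ₁ γ₂ γ₃) p idx4 = 0 := by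
  simp [mul_fMat_apply, not_eq_of_blkOf]

@[simp] theorem mul_fMat_idx5 (r : Fin k) :
    (M * fMat l₁ l₂ γ₁ γ₂ γ₃) p (idx5 r) = 0 := by
  simp [mul_fMat_apply, not_eq_of_blkOf]

@[simp] theorem mul_fMat_idx6 :
    (M * fMat l₁ l₂ γ₁ γ₂ γ₃) p idx6 = M p idx7 * γ₃ := by
  simp [mul_fMat_apply, not_eq_of_blkOf]

@[simp] theorem mul_fMat_idx7 :
    (M * fMat l₁ l₂ γ₁ γ₂ γ₃) p idx7 = 0 := by
  simp [mul_fMat_apply, not_eq_of_blkOf]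

@[simp] theorem mul_fMat_idx8 (r : Fin m) :
    (M * fMat l₁ l₂ γ₁ γ₂ γ₃) p (idx8 r) = 0 := by
  simp [mul_fMat_apply, not_eq_of_blkOf]

@[simp] theorem fMat_idx0_mul (r : Fin m) :
    (fMat l₁ l₂ γ₁ γ₂ γ₃ * M) (idx0 r) q = 0 := by
  simp [fMat_mul_apply, not_eq_of_blkOf]

@[simp] theorem fMat_idx1_mul :
    (fMat l₁ l₂ γ₁ γ₂ γ₃ * M) idx1 q = 0 := by
  simp [fMat_mul_apply, not_eq_of_blkOf]

@[simp] theorem fMat_idx2_mul :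
    (fMat l₁ l₂ γ₁ γ₂ γ₃ * M) idx2 q = 0 := by
  simp [fMat_mul_apply, not_eq_of_blkOf]

@[simp] theorem fMat_idx3_mul (r : Fin k) :
    (fMat l₁ l₂ γ₁ γ₂ γ₃ * M) (idx3 r) q = 0 := by
  simp [fMat_mul_apply, not_eq_of_blkOf]

@[simp] theorem fMat_idx4_mul :
    (fMat l₁ l₂ γ₁ γ₂ γ₃ * M) idx4 q = 0 := by
  simp [fMat_mul_apply, not_eq_of_blkOf]

@[simp] theorem fMat_idx5_mul (r : Fin k) :
    (fMat l₁ l₂ γ₁ γ₂ γ₃ * M) (idx5 r) q = l₂ (Fin.rev r) * M (idx3 (Fin.rev r)) q := by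
  simp [fMat_mul_apply, not_eq_of_blkOf]

@[simp] theorem fMat_idx6_mul :
    (fMat l₁ l₂ γ₁ γ₂ γ₃ * M) idx6 q = γ₁ * M idx1 q := by
  simp [fMat_mul_apply, not_eq_of_blkOf]

@[simp] theorem fMat_idx7_mul :
    (fMat l₁ l₂ γ₁ γ₂ γ₃ * M) idx7 q = γ₂ * M idx2 q + γ₃ * M idx6 q := by
  simp [fMat_mul_apply, not_eq_of_blkOf]

@[simp] theorem fMat_idx8_mul (r : Fin m) :
    (fMat l₁ l₂ γ₁ γ₂ γ₃ * M) (idx8 r) q = l₁ (Fin.rev r) * M (idx0 (Fin.rev r)) q := by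
  simp [fMat_mul_apply, not_eq_of_blkOf]

end FormMultiplication

/-! ### The stabilizer of the form. -/

section Stabilizer

variable {m k : ℕ}

/-- The blocks in which `g - 1` can be nonzero, for `g` in the stabilizer of `f`. -/
def stabBlocks : Finset (Fin 9 × Fin 9) := {(0, 8), (1, 2), (1, 6), (1, 7), (2, 7), (3, 5), (6, 7)}

/-- The matrices `x` for which `x f - f x` is upper triangular. -/
structure IsStab (γ₁ γ₂ : ℝ) (x : Matrix (Idx m k) (Idx m k) ℝ) : Prop where
  blocks : ∀ p q, (blkOf p, blkOf q) ∉ stabBlocks → x p q = 0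
  anti₁ : ∀ r c, c ≠ Fin.rev r → x (idx0 r) (idx8 c) = 0
  anti₂ : ∀ r c, c ≠ Fin.rev r → x (idx3 r) (idx5 c) = 0
  rel : γ₁ * x idx1 idx2 = γ₂ * x idx6 idx7

variable {l₁ : Fin m → ℝ} {l₂ : Fin k → ℝ} {γ₁ γ₂ γ₃ : ℝ}
  {x : Matrix (Idx m k) (Idx m k) ℝ}

variable {l₁ : Fin m → ℝ} {l₂ : Fin k → ℝ} {γ₁ γ₂ γ₃ : ℝ}
  {x : Matrix (Idx m k) (Idx m k) ℝ}

theorem IsStab.isUpper (hx : IsStab γ₁ γ₂ x) :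
    IsUpper (x * fMat l₁ l₂ γ₁ γ₂ γ₃ - fMat l₁ l₂ γ₁ γ₂ γ₃ * x) := by
  intro p q hqp
  rw [Matrix.sub_apply, sub_eq_zero]
  have hb : decide (blkOf q ≤ blkOf p) = true := decide_eq_true (blkOf_mono hqp.le)
  have hs : ∀ p q, decide ((blkOf p, blkOf q) ∈ stabBlocks) = false → x p q = 0 := fun p q h =>
    hx.blocks p q (of_decide_eq_false h)
  rcases idx_cases p with
    ⟨r, rfl⟩ | rfl | rfl | ⟨r, rfl⟩ | rfl | ⟨r, rfl⟩ | rfl | rfl | ⟨r, rfl⟩ <;>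
  rcases idx_cases q with
    ⟨c, rfl⟩ | rfl | rfl | ⟨c, rfl⟩ | rfl | ⟨c, rfl⟩ | rfl | rfl | ⟨c, rfl⟩ <;>
  first
  | exact Bool.noConfusion (show false = true from hb)
  | exact absurd hqp (lt_irrefl _)
  | (simp [hs, stabBlocks]; done)
  | skip
  -- Of the 81 pairs of blocks only (0,0), (3,3), (5,5), (6,2) and (8,8) are not settled by the
  -- support. In the four diagonal ones, an entry strictly below the diagonal corresponds to an
  -- entry off the second diagonal of block (0,8) or (3,5).
  · simp [hx.anti₁ r (Fin.rev c) (fun h => (idx0_lt.1 hqp).ne (Fin.rev_injective h))]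
  · simp [hx.anti₂ r (Fin.rev c) (fun h => (idx3_lt.1 hqp).ne (Fin.rev_injective h))]
  · simp [hx.anti₂ (Fin.rev r) c (by simpa using (idx5_lt.1 hqp).ne)]
  · simpa [mul_comm] using hx.rel.symm
  · simp [hx.anti₁ (Fin.rev r) c (by simpa using (idx8_lt.1 hqp).ne)]

theorem isStab_of_isUpper (hl₁ : ∀ r, l₁ r ≠ 0) (hl₂ : ∀ r, l₂ r ≠ 0) (hγ₁ : γ₁ ≠ 0)
    (hγ₂ : γ₂ ≠ 0) (hx : ∀ p q, q ≤ p → x p q = 0)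
    (hu : IsUpper (x * fMat l₁ l₂ γ₁ γ₂ γ₃ - fMat l₁ l₂ γ₁ γ₂ γ₃ * x)) : IsStab γ₁ γ₂ x := by
  have H : ∀ p q, q < p → (x * fMat l₁ l₂ γ₁ γ₂ γ₃) p q = (fMat l₁ l₂ γ₁ γ₂ γ₃ * x) p q :=
    fun p q h => sub_eq_zero.1 (hu p q h)
  have hlo : ∀ p q, decide (blkOf q < blkOf p) = true → x p q = 0 := fun p q h =>
    hx p q (lt_of_blkOf_lt (of_decide_eq_true h)).le
  have H' : ∀ p q, decide (blkOf q < blkOf p) = true →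
      (x * fMat l₁ l₂ γ₁ γ₂ γ₃) p q = (fMat l₁ l₂ γ₁ γ₂ γ₃ * x) p q :=
    fun p q h => H p q (lt_of_blkOf_lt (of_decide_eq_true h))
  -- The equations are solved from the outer blocks inwards. An entry of `x` is isolated at a place
  -- where the other product only meets entries of `x` already known to vanish; `c` and `r` name the
  -- column or row block that is cleared.
  have c8 : ∀ p c, decide (blkOf p = 0) = false → x p (idx8 c) = 0 := by
    intro p c hp
    have H1 := H' p (idx0 (Fin.rev c))
    rcases idx_cases p with ⟨r, rfl⟩ | rfl | rfl | ⟨r, rfl⟩ | rfl | ⟨r, rfl⟩ | rfl | rfl | ⟨r, rfl⟩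
    · simp at hp
    on_goal 8 =>
      rcases le_or_gt c r with h | h
      · rcases h.eq_or_lt with rfl | h
        · exact hx _ _ le_rfl
        · exact hx _ _ (idx8_lt.2 h).le
      have := H' (idx8 r) (idx0 (Fin.rev c)) rfl
      simpa [hl₁, hx _ _ (idx0_lt.2 (Fin.rev_lt_rev.2 h)).le] using this
    all_goals
      have := H1 rfl
      simpa [hl₁, hlo] using this
  have r0 : ∀ q r, decide (blkOf q = 8) = false → x (idx0 r) q = 0 := by
    intro q r hq
    have H1 := H' (idx8 (Fin.rev r)) q
    rcases idx_cases q with ⟨c, rfl⟩ | rfl | rfl | ⟨c, rfl⟩ | rfl | ⟨c, rfl⟩ | rfl | rfl | ⟨c, rfl⟩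
    on_goal 9 => simp at hq
    · rcases le_or_gt c r with h | h
      · rcases h.eq_or_lt with rfl | h
        · exact hx _ _ le_rfl
        · exact hx _ _ (idx0_lt.2 h).le
      have := H' (idx8 (Fin.rev r)) (idx0 c) rfl
      simpa [hl₁, hx _ _ (idx8_lt.2 (Fin.rev_lt_rev.2 h)).le] using this.symm
    all_goals
      have := H1 rfl
      simpa [hl₁, hlo, c8] using this.symm
  have c7 : ∀ p, decide (blkOf p ∈ ({1, 2, 6} : Finset (Fin 9))) = false → x p idx7 = 0 := by
    intro p hp
    have H1 := H' p idx2
    rcases idx_cases p with ⟨r, rfl⟩ | rfl | rfl | ⟨r, rfl⟩ | rfl | ⟨r, rfl⟩ | rfl | rfl | ⟨r, rfl⟩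
    · exact r0 _ _ rfl
    · simp at hp
    · simp at hp
    on_goal 4 => simp at hp
    on_goal 4 => exact hx _ _ le_rfl
    on_goal 4 => exact hlo _ _ rfl
    all_goals
      have := H1 rfl
      simpa [hγ₂, hlo] using this
  have c6 : ∀ p, decide (blkOf p = 1) = false → x p idx6 = 0 := by
    intro p hp
    have H1 := H' p idx1
    rcases idx_cases p with ⟨r, rfl⟩ | rfl | rfl | ⟨r, rfl⟩ | rfl | ⟨r, rfl⟩ | rfl | rfl | ⟨r, rfl⟩
    · exact r0 _ _ rfl
    · simp at hp
    on_goal 5 => exact hx _ _ le_rfl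
    on_goal 5 => exact hlo _ _ rfl
    on_goal 5 => exact hlo _ _ rfl
    all_goals
      have := H1 rfl
      simpa [hγ₁, hlo] using this
  have r1 : ∀ q, decide (blkOf q ∈ ({3, 4, 5} : Finset (Fin 9))) = true → x idx1 q = 0 := by
    intro q hq
    have H1 := H' idx6 q
    rcases idx_cases q with
      ⟨r, rfl⟩ | rfl | rfl | ⟨r, rfl⟩ | rfl | ⟨r, rfl⟩ | rfl | rfl | ⟨r, rfl⟩ <;>
    first
    | exact Bool.noConfusion (show false = true from hq)
    | (have := H1 rfl
       simpa [hγ₁, hlo, c7, c8, c6] using this.symm)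
  have r2 : ∀ q, decide (blkOf q ∈ ({3, 4, 5} : Finset (Fin 9))) = true → x idx2 q = 0 := by
    intro q hq
    have H1 := H' idx7 q
    rcases idx_cases q with
      ⟨r, rfl⟩ | rfl | rfl | ⟨r, rfl⟩ | rfl | ⟨r, rfl⟩ | rfl | rfl | ⟨r, rfl⟩ <;>
    first
    | exact Bool.noConfusion (show false = true from hq)
    | (have := H1 rfl
       simpa [hγ₂, hlo, c7, c8, c6] using this.symm)
  have c5 : ∀ p c, decide (blkOf p ∈ ({4, 5} : Finset (Fin 9))) = true → x p (idx5 c) = 0 := by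
    intro p c hp
    rcases idx_cases p with
      ⟨r, rfl⟩ | rfl | rfl | ⟨r, rfl⟩ | rfl | ⟨r, rfl⟩ | rfl | rfl | ⟨r, rfl⟩ <;>
    first
    | exact Bool.noConfusion (show false = true from hp)
    | skip
    · have := H' idx4 (idx3 (Fin.rev c)) rfl
      simpa [hl₂, hlo] using this
    · rcases le_or_gt c r with h | h
      · rcases h.eq_or_lt with rfl | h
        · exact hx _ _ le_rfl
        · exact hx _ _ (idx5_lt.2 h).le
      have := H' (idx5 r) (idx3 (Fin.rev c)) rfl
      simpa [hl₂, hx _ _ (idx3_lt.2 (Fin.rev_lt_rev.2 h)).le] using this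
  have r3 : ∀ q r, decide (blkOf q ∈ ({3, 4} : Finset (Fin 9))) = true → x (idx3 r) q = 0 := by
    intro q r hq
    rcases idx_cases q with
      ⟨c, rfl⟩ | rfl | rfl | ⟨c, rfl⟩ | rfl | ⟨c, rfl⟩ | rfl | rfl | ⟨c, rfl⟩ <;>
    first
    | exact Bool.noConfusion (show false = true from hq)
    | skip
    · rcases le_or_gt c r with h | h
      · rcases h.eq_or_lt with rfl | h
        · exact hx _ _ le_rfl
        · exact hx _ _ (idx3_lt.2 h).le
      have := H' (idx5 (Fin.rev r)) (idx3 c) rfl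
      simpa [hl₂, hx _ _ (idx5_lt.2 (Fin.rev_lt_rev.2 h)).le] using this.symm
    · have := H' (idx5 (Fin.rev r)) idx4 rfl
      simpa [hl₂, hlo] using this.symm
  refine ⟨fun p q h => ?_, fun r c h => ?_, fun r c h => ?_, ?_⟩
  · replace h := decide_eq_false h
    rcases idx_cases p with
      ⟨r, rfl⟩ | rfl | rfl | ⟨r, rfl⟩ | rfl | ⟨r, rfl⟩ | rfl | rfl | ⟨r, rfl⟩ <;>
    rcases idx_cases q with
      ⟨c, rfl⟩ | rfl | rfl | ⟨c, rfl⟩ | rfl | ⟨c, rfl⟩ | rfl | rfl | ⟨c, rfl⟩ <;>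
    first
    | exact Bool.noConfusion (show true = false from h)
    | exact hlo _ _ rfl
    | exact hx _ _ le_rfl
    | exact r0 _ _ rfl
    | exact r1 _ rfl
    | exact r2 _ rfl
    | exact r3 _ _ rfl
    | exact c5 _ _ rfl
    | exact c6 _ rfl
    | exact c7 _ rfl
    | exact c8 _ _ rfl
  -- An entry to the left of the second diagonal appears below the diagonal of block (8,8) of `f x`,
  -- one to the right of it below the diagonal of block (0,0) of `x f`. The pair (5,5), (3,3) plays
  -- the same role for the block (3,5).
  · rcases lt_or_gt_of_ne h with h | h
    · have := H (idx8 (Fin.rev r)) (idx8 c) (idx8_lt.2 h)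
      simpa [hl₁] using this.symm
    · have := H (idx0 r) (idx0 (Fin.rev c)) (idx0_lt.2 (by rwa [Fin.rev_lt_iff]))
      simpa [hl₁] using this
  · rcases lt_or_gt_of_ne h with h | h
    · have := H (idx5 (Fin.rev r)) (idx5 c) (idx5_lt.2 h)
      simpa [hl₂] using this.symm
    · have := H (idx3 r) (idx3 (Fin.rev c)) (idx3_lt.2 (by rwa [Fin.rev_lt_iff]))
      simpa [hl₂] using this
  · have := H' idx6 idx2 rfl
    simpa [mul_comm] using this.symm

/-- Replacing `g` by `g - 1` does not change the commutator with `f`. The parameter `γ₃` drops out: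
below the diagonal it only multiplies entries of `g - 1` that lie on or below the diagonal. -/
theorem mem_coadStabilizer_fMat_iff (hl₁ : ∀ r, l₁ r ≠ 0) (hl₂ : ∀ r, l₂ r ≠ 0) (hγ₁ : γ₁ ≠ 0)
    (hγ₂ : γ₂ ≠ 0) (g : UT (Idx m k)) :
    g ∈ coadStabilizer (fMat l₁ l₂ γ₁ γ₂ γ₃) ↔ IsStab γ₁ γ₂ (mat g - 1) := by
  rw [mem_coadStabilizer_iff]
  have e : mat g * fMat l₁ l₂ γ₁ γ₂ γ₃ - fMat l₁ l₂ γ₁ γ₂ γ₃ * mat g =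
      (mat g - 1) * fMat l₁ l₂ γ₁ γ₂ γ₃ - fMat l₁ l₂ γ₁ γ₂ γ₃ * (mat g - 1) := by
    rw [sub_mul, mul_sub, one_mul, mul_one, sub_sub_sub_cancel_right]
  rw [e]
  refine ⟨fun h => isStab_of_isUpper hl₁ hl₂ hγ₁ hγ₂ (fun p q hqp => ?_) h, IsStab.isUpper⟩
  rcases hqp.eq_or_lt with rfl | hqp
  · rw [Matrix.sub_apply, mat_diag, Matrix.one_apply_eq, sub_self]
  · rw [Matrix.sub_apply, mat_lower g hqp, Matrix.one_apply_ne hqp.ne', sub_self]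

end Stabilizer

/-! ### Lower left corners and bordered minors under upper triangular multiplication. -/

section Corners

variable {m k : ℕ}

/-- The entries in the rows of the blocks from `i` on and the columns of the blocks up to `j`
vanish. -/
def CornerZero (i j : Fin 9) (Z : Matrix (Idx m k) (Idx m k) ℝ) : Prop :=
  ∀ p q, i ≤ blkOf p → blkOf q ≤ j → Z p q = 0

/-- An entry `(p, q)` of `H Z K` only involves entries `(s, t)` of `Z` with `s ≥ p` and `t ≤ q`, and
these stay in the corner. -/
theorem CornerZero.mul_mul {i j : Fin 9} {Z H K : Matrix (Idx m k) (Idx m k) ℝ}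
    (hZ : CornerZero i j Z) (hH : IsUpper H) (hK : IsUpper K) : CornerZero i j (H * Z * K) := by
  intro p q hp hq
  rw [Matrix.mul_apply]
  refine Finset.sum_eq_zero fun t _ => ?_
  rcases lt_or_ge q t with h | h
  · rw [hK t q h, mul_zero]
  rw [Matrix.mul_apply, Finset.sum_eq_zero, zero_mul]
  intro s _
  rcases lt_or_ge s p with h' | h'
  · rw [hH p s h', zero_mul]
  · rw [hZ s t (hp.trans (blkOf_mono h')) ((blkOf_mono h).trans hq), mul_zero]

theorem CornerZero.blk_eq_zero {i j : Fin 9} {Z : Matrix (Idx m k) (Idx m k) ℝ}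
    (hZ : CornerZero i j Z) {a b : Fin 9} (ha : i ≤ a) (hb : b ≤ j) : blk Z a b = 0 := by
  ext r q
  exact hZ _ _ ha hb

theorem det_mul_eq_zero_of_card_lt {κ μ : Type} [Fintype κ] [Fintype μ] [DecidableEq κ]
    (h : Fintype.card μ < Fintype.card κ) (A : Matrix κ μ ℝ) (B : Matrix μ κ ℝ) :
    (A * B).det = 0 := by
  by_contra hne
  have h₁ : (A * B).rank = Fintype.card κ :=
    Matrix.rank_of_isUnit _ ((Matrix.isUnit_iff_isUnit_det _).2 (isUnit_iff_ne_zero.2 hne))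
  have h₂ := (Matrix.rank_mul_le_left A B).trans (Matrix.rank_le_card_width A)
  omega

theorem rowBlk_injective : Function.Injective rowBlk := by decide

theorem colBlk_injective : Function.Injective colBlk := by decide

theorem minorRow_injective (i j : Fin 9) :
    Function.Injective (minorRow : MinorIdx m k i j → Idx m k) := by
  rintro ⟨⟨s, hs⟩, r⟩ ⟨⟨t, ht⟩, q⟩ h
  obtain rfl : s = t := rowBlk_injective (congrArg blkOf h)
  obtain rfl := pos_injective _ h
  rfl

theorem minorCol_injective (i j : Fin 9) :
    Function.Injective (minorCol : MinorIdx m k i j → Idx m k) := by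
  rintro ⟨⟨s, hs⟩, r⟩ ⟨⟨t, ht⟩, q⟩ h
  obtain rfl : s = t := colBlk_injective (congrArg blkOf h)
  obtain rfl := Fin.cast_injective _ (pos_injective _ h)
  rfl

theorem mem_range_minorRow {i j : Fin 9} {p : Idx m k} (s : PhiOf i j)
    (h : blkOf p = rowBlk s.1) : p ∈ Set.range (minorRow : MinorIdx m k i j → Idx m k) := by
  obtain ⟨r, hr⟩ := pos_surj p
  generalize blkOf p = b at *
  subst h hr
  exact ⟨⟨s, r⟩, rfl⟩

theorem mem_range_minorCol {i j : Fin 9} {p : Idx m k} (s : PhiOf i j)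
    (h : blkOf p = colBlk s.1) : p ∈ Set.range (minorCol : MinorIdx m k i j → Idx m k) := by
  obtain ⟨r, hr⟩ := pos_surj p
  generalize blkOf p = b at *
  subst h hr
  exact ⟨⟨s, Fin.cast (size_rowBlk m k s.1).symm r⟩, rfl⟩

theorem card_lt_card_sum_unit (κ : Type) [Fintype κ] :
    Fintype.card κ < Fintype.card (κ ⊕ Unit) := by
  simp

/-- If the corner of `Z` at the blocks `i`, `j` has its support in the rows of `Δ`, then the
bordered minors of `H Z K` vanish. -/
theorem det_bordered_eq_zero_of_rows {i j : Fin 9} {Z H K : Matrix (Idx m k) (Idx m k) ℝ}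
    (hH : IsUpper H) (hK : IsUpper K)
    (hZ : ∀ p q, i ≤ blkOf p → blkOf q ≤ j → p ∉ Set.range (minorRow (i := i) (j := j)) →
      Z p q = 0) (ρ κ : MinorIdx m k i j ⊕ Unit → Idx m k) (hρ : ∀ u, i ≤ blkOf (ρ u))
    (hκ : ∀ u, blkOf (κ u) ≤ j) : ((H * Z * K).submatrix ρ κ).det = 0 := by
  -- On the chosen rows and columns the product factors through the rows of `Δ`. Its rank is
  -- therefore at most the size of `Δ`, one less than the size of the bordered minor.
  have e : (H * Z * K).submatrix ρ κ =
      H.submatrix ρ (minorRow (i := i) (j := j)) * (Z * K).submatrix minorRow κ := by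
    ext u v
    rw [mul_assoc, Matrix.submatrix_apply]
    refine (Matrix.mul_apply ..).trans (Eq.trans ?_ (Matrix.mul_apply ..).symm)
    refine (Fintype.sum_of_injective _ (minorRow_injective i j) _ _ (fun s hs => ?_)
      fun x => rfl).symm
    rcases lt_or_ge s (ρ u) with h | h
    · rw [hH _ _ h, zero_mul]
    rw [Matrix.mul_apply, Finset.sum_eq_zero, mul_zero]
    intro t _
    rcases lt_or_ge (κ v) t with h' | h'
    · rw [hK _ _ h', mul_zero]
    · rw [hZ s t ((hρ u).trans (blkOf_mono h)) ((blkOf_mono h').trans (hκ v)) hs, zero_mul]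
  rw [e]
  exact det_mul_eq_zero_of_card_lt (card_lt_card_sum_unit _) _ _

/-- If the corner of `Z` at the blocks `i`, `j` has its support in the columns of `Δ`, then the
bordered minors of `H Z K` vanish. -/
theorem det_bordered_eq_zero_of_cols {i j : Fin 9} {Z H K : Matrix (Idx m k) (Idx m k) ℝ}
    (hH : IsUpper H) (hK : IsUpper K)
    (hZ : ∀ p q, i ≤ blkOf p → blkOf q ≤ j → q ∉ Set.range (minorCol (i := i) (j := j)) →
      Z p q = 0) (ρ κ : MinorIdx m k i j ⊕ Unit → Idx m k) (hρ : ∀ u, i ≤ blkOf (ρ u))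
    (hκ : ∀ u, blkOf (κ u) ≤ j) : ((H * Z * K).submatrix ρ κ).det = 0 := by
  have e : (H * Z * K).submatrix ρ κ =
      (H * Z).submatrix ρ (minorCol (i := i) (j := j)) * K.submatrix minorCol κ := by
    ext u v
    rw [Matrix.submatrix_apply]
    refine (Matrix.mul_apply ..).trans (Eq.trans ?_ (Matrix.mul_apply ..).symm)
    refine (Fintype.sum_of_injective _ (minorCol_injective i j) _ _ (fun s hs => ?_)
      fun x => rfl).symm
    rcases lt_or_ge (κ v) s with h | h
    · rw [hK _ _ h, mul_zero]
    rw [Matrix.mul_apply, Finset.sum_eq_zero, zero_mul]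
    intro t _
    rcases lt_or_ge t (ρ u) with h' | h'
    · rw [hH _ _ h', zero_mul]
    · rw [hZ t s ((hρ u).trans (blkOf_mono h')) ((blkOf_mono h).trans (hκ v)) hs, mul_zero]
  rw [e]
  exact det_mul_eq_zero_of_card_lt (card_lt_card_sum_unit _) _ _

theorem le_blkOf_row {i j : Fin 9} (r : Fin (size m k i)) (u : MinorIdx m k i j ⊕ Unit) :
    i ≤ blkOf (Sum.elim (minorRow (i := i) (j := j)) (fun _ => pos i r) u) := by
  rcases u with u | u
  · exact u.1.2.1.le
  · exact le_rfl

theorem blkOf_col_le {i j : Fin 9} (q : Fin (size m k j)) (u : MinorIdx m k i j ⊕ Unit) :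
    blkOf (Sum.elim (minorCol (i := i) (j := j)) (fun _ => pos j q) u) ≤ j := by
  rcases u with u | u
  · exact u.1.2.2.le
  · exact le_rfl

/-- No minor in the equations `c̃` meets the diagonal, so each may be computed from `g - 1`, which
transforms linearly under conjugation. -/
theorem submatrix_sub_one_of_ne (M : Matrix (Idx m k) (Idx m k) ℝ) {ρ κ : Type}
    (f : ρ → Idx m k) (g : κ → Idx m k) (h : ∀ u v, f u ≠ g v) :
    (M - 1).submatrix f g = M.submatrix f g := by
  ext u v
  simp [Matrix.one_apply_ne (h u v)]

theorem bordered_ne {i j : Fin 9} (hij : i ≠ j)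
    (h : ∀ s : PhiOf i j, i ≠ colBlk s.1 ∧ rowBlk s.1 ≠ j)
    (r : Fin (size m k i)) (q : Fin (size m k j)) (u v : MinorIdx m k i j ⊕ Unit) :
    Sum.elim (minorRow (i := i) (j := j)) (fun _ => pos i r) u ≠
      Sum.elim (minorCol (i := i) (j := j)) (fun _ => pos j q) v := by
  have hs : ∀ s t, rowBlk s ≠ colBlk t := by decide
  rcases u with u | u <;> rcases v with v | v
  · exact ne_of_blkOf_ne (hs _ _)
  · exact ne_of_blkOf_ne (h _).2
  · exact ne_of_blkOf_ne (h _).1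
  · exact ne_of_blkOf_ne hij

/-- The marked blocks as a finite set. -/
def bulletList : Finset (Fin 9 × Fin 9) :=
  {(0, 1), (0, 3), (0, 4), (0, 6), (2, 3), (2, 4), (2, 6), (2, 8), (3, 4), (4, 5), (4, 6), (4, 8),
    (5, 6), (5, 8), (7, 8)}

theorem mem_bulletList {x : Fin 9 × Fin 9} (h : x ∈ bullets) : x ∈ bulletList := by
  simpa [bullets, bulletList] using h

theorem bullet_ne {i j : Fin 9} (h : (i, j) ∈ bullets) :
    i ≠ j ∧ ∀ s : PhiOf i j, i ≠ colBlk s.1 ∧ rowBlk s.1 ≠ j := by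
  have key : ∀ x ∈ bulletList, x.1 ≠ x.2 ∧
      ∀ s : Fin 3, x.1 < rowBlk s → colBlk s < x.2 → x.1 ≠ colBlk s ∧ rowBlk s ≠ x.2 := by decide
  obtain ⟨h₁, h₂⟩ := key _ (mem_bulletList h)
  exact ⟨h₁, fun s => h₂ s.1 s.2.1 s.2.2⟩

theorem evalAt_ΔTilde_sub_one (g : UT (Idx m k)) {i j : Fin 9} (h : (i, j) ∈ bullets)
    (r : Fin (size m k i)) (q : Fin (size m k j)) : evalAt g (ΔTilde m k i j r q) =
      ((mat g - 1).submatrix (Sum.elim (minorRow (i := i) (j := j)) fun _ : Unit => pos i r)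
        (Sum.elim (minorCol (i := i) (j := j)) fun _ : Unit => pos j q)).det := by
  rw [evalAt_ΔTilde, submatrix_sub_one_of_ne]
  exact bordered_ne (bullet_ne h).1 (bullet_ne h).2 r q

end Corners

/-! ### Conjugates of the stabilizer satisfy the equations. -/

section Saturation

variable {m k : ℕ} {γ₁ γ₂ : ℝ}

theorem blk_sub_one (M : Matrix (Idx m k) (Idx m k) ℝ) {a b : Fin 9} (h : a ≠ b) :
    blk (M - 1) a b = blk M a b :=
  submatrix_sub_one_of_ne M _ _ fun _ _ => ne_of_blkOf_ne h

theorem blk_diag_eq_one {a : Fin 9} [Subsingleton (Fin (size m k a))] (g : UT (Idx m k)) :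
    blk (mat g) a a = 1 := by
  ext r q
  obtain rfl := Subsingleton.elim r q
  rw [Matrix.one_apply_eq]
  exact mat_diag g _

theorem det_blk_diag (a : Fin 9) (g : UT (Idx m k)) : (blk (mat g) a a).det = 1 := by
  have hu : (blk (mat g) a a).IsUpperTriangular := fun i j h => mat_lower g (pos_lt_pos.2 h)
  rw [Matrix.det_of_isUpperTriangular hu]
  exact Finset.prod_eq_one fun i _ => mat_diag g _

theorem IsUpper.blk_eq_zero {H : Matrix (Idx m k) (Idx m k) ℝ} (hH : IsUpper H) {a b : Fin 9}
    (h : b < a) : blk H a b = 0 := by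
  ext r q
  exact hH _ _ (lt_of_blkOf_lt h)

/-- If `(a, b)` is the only place in its corner where `X` has a nonzero block, then multiplication
by upper triangular matrices affects this block through the diagonal blocks only. -/
theorem blk_conj_of_corner {X H K : Matrix (Idx m k) (Idx m k) ℝ}
    (hb : ∀ p q, (blkOf p, blkOf q) ∉ stabBlocks → X p q = 0) (hH : IsUpper H) (hK : IsUpper K)
    {a b : Fin 9} (hab : ∀ y ∈ stabBlocks, a ≤ y.1 → y.2 ≤ b → y = (a, b)) :
    blk (H * X * K) a b = blk H a a * blk X a b * blk K b b := by
  have hz : ∀ d c, a ≤ d → c ≤ b → (d, c) ≠ (a, b) → blk X d c = 0 := by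
    intro d c hd hc hne
    ext r q
    exact hb _ _ fun hm => hne (hab _ hm hd hc)
  have h₁ : ∀ c ≤ b, blk (H * X) a c = blk H a a * blk X a c := by
    intro c hc
    rw [blk_mul]
    refine Finset.sum_eq_single a (fun d _ hda => ?_) (by simp)
    rcases lt_or_gt_of_ne hda with h | h
    · rw [hH.blk_eq_zero h, Matrix.zero_mul]
    · rw [hz d c h.le hc (fun e => hda (congrArg Prod.fst e)), Matrix.mul_zero]
  rw [blk_mul, Finset.sum_eq_single b, h₁ b le_rfl]
  · intro c _ hcb
    rcases lt_or_gt_of_ne hcb with h | h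
    · rw [h₁ c h.le, hz a c le_rfl h.le (fun e => hcb (congrArg Prod.snd e)), Matrix.mul_zero,
        Matrix.zero_mul]
    · rw [hK.blk_eq_zero h, Matrix.mul_zero]
  · simp

-- Each equation is a statement on one lower left corner of `g - 1` or of `(g - 1)²`, so it is
-- enough to inspect which blocks of `stabBlocks` lie in that corner.
set_option maxRecDepth 10000 in
theorem conj_stab_mem_zeroSet {h x : UT (Idx m k)} (hx : IsStab γ₁ γ₂ (mat x - 1))
    (hd : evalAt (h * x * h⁻¹) (d₁ m k) ≠ 0) :
    h * x * h⁻¹ ∈ zeroSet (d₁ m k) (I' m k γ₁ γ₂) := by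
  set g := h * x * h⁻¹ with hg
  set X := mat x - 1 with hX
  have hY : mat g - 1 = mat h * X * mat h⁻¹ := mat_conj_sub_one h x
  have hb : ∀ p q, (blkOf p, blkOf q) ∉ stabBlocks → X p q = 0 := hx.blocks
  have hc : ∀ i j : Fin 9, (∀ y ∈ stabBlocks, i ≤ y.1 → y.2 ≤ j → False) →
      CornerZero i j (mat g - 1) := by
    intro i j hij
    rw [hY]
    refine CornerZero.mul_mul (fun p q hp hq => hb p q fun hmem => ?_) (isUpper_mat _)
      (isUpper_mat _)
    exact hij _ hmem hp hq
  -- The only two-step paths through `stabBlocks` are 1 → 2 → 7 and 1 → 6 → 7. The square of `X` is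
  -- thus supported in the block (1,7), which lies in neither of the corners (1,5) and (3,7) used
  -- below.
  have hc2 : ∀ i j : Fin 9, (∀ y ∈ stabBlocks, ∀ z ∈ stabBlocks, y.2 = z.1 → i ≤ y.1 → z.2 ≤ j →
      False) → CornerZero i j ((mat g - 1) * (mat g - 1)) := by
    intro i j hij
    rw [hY, conj_mul_conj]
    refine CornerZero.mul_mul (fun p q hp hq => ?_) (isUpper_mat _) (isUpper_mat _)
    rw [Matrix.mul_apply]
    refine Finset.sum_eq_zero fun t _ => ?_
    by_cases h₁ : (blkOf p, blkOf t) ∈ stabBlocks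
    · by_cases h₂ : (blkOf t, blkOf q) ∈ stabBlocks
      · exact (hij _ h₁ _ h₂ rfl hp hq).elim
      · rw [hb t q h₂, mul_zero]
    · rw [hb p t h₁, zero_mul]
  refine (mem_zeroSet_iff γ₁ γ₂ g).2 ⟨hd, ?_, ?_, ?_⟩
  · rintro _ ⟨b, hbb, r, q, hrq, rfl⟩
    rw [evalAt_block]
    have h₀ : ∀ b : Fin 9, ∀ y ∈ stabBlocks, b ≤ y.1 → y.2 ≤ b → False := by decide
    have := hc b b (h₀ b) (pos b r) (pos b q) le_rfl le_rfl
    rwa [Matrix.sub_apply, Matrix.one_apply_ne (pos_lt_pos.2 hrq).ne, sub_zero] at this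
  · intro i j hij r q
    rw [evalAt_ΔTilde_sub_one g hij, hY]
    -- The corner at (2,8) contains the block (2,7), whose row is not a row of `Δ` but whose column
    -- is one of its columns. For every other marked block the rows suffice.
    by_cases h28 : (i, j) = (2, 8)
    · refine det_bordered_eq_zero_of_cols (isUpper_mat _) (isUpper_mat _) ?_ _ _ (le_blkOf_row r)
        (blkOf_col_le q)
      intro p q hp hq hr
      refine hb p q fun hmem => hr ?_
      have key : ∀ y ∈ stabBlocks, (2 : Fin 9) ≤ y.1 → y.2 ≤ (8 : Fin 9) →
          ∃ s : Fin 3, ((2 : Fin 9) < rowBlk s ∧ colBlk s < (8 : Fin 9)) ∧ y.2 = colBlk s := by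
        decide
      obtain ⟨rfl, rfl⟩ := Prod.mk.inj h28
      obtain ⟨s, hs, hs'⟩ := key _ hmem hp hq
      exact mem_range_minorCol ⟨s, hs⟩ hs'
    · refine det_bordered_eq_zero_of_rows (isUpper_mat _) (isUpper_mat _) ?_ _ _ (le_blkOf_row r)
        (blkOf_col_le q)
      intro p q hp hq hr
      refine hb p q fun hmem => hr ?_
      have key : ∀ x ∈ bulletList, x ≠ (2, 8) → ∀ y ∈ stabBlocks, x.1 ≤ y.1 → y.2 ≤ x.2 →
          ∃ s : Fin 3, (x.1 < rowBlk s ∧ colBlk s < x.2) ∧ y.1 = rowBlk s := by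
        decide
      obtain ⟨s, hs, hs'⟩ := key _ (mem_bulletList hij) h28 _ hmem hp hq
      exact mem_range_minorRow ⟨s, hs⟩ hs'
  · rintro φ ((⟨r, q, rfl⟩ | ⟨r, q, rfl⟩) | rfl)
    · rw [Matrix.add_apply, map_add, evalAt_block_mul, evalAt_block_mul, ← Matrix.add_apply]
      -- The block (1,5) of `(g - 1)²` reduces to the two terms of the equation, the other factors
      -- being zero by `h₂` and `h₃`. The second quadratic equation is the block (3,7) in the same
      -- way.
      have h₁ := (hc2 1 5 (by decide)).blk_eq_zero (a := 1) (b := 5) le_rfl le_rfl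
      have h₂ := hc 1 1 (by decide)
      have h₃ := hc 4 5 (by decide)
      rw [blk_mul, sum_fin_nine, h₂.blk_eq_zero (b := 0) le_rfl (by decide),
        h₂.blk_eq_zero (b := 1) le_rfl le_rfl, h₃.blk_eq_zero (a := 4) le_rfl le_rfl,
        h₃.blk_eq_zero (a := 5) (by decide) le_rfl, h₃.blk_eq_zero (a := 6) (by decide) le_rfl,
        h₃.blk_eq_zero (a := 7) (by decide) le_rfl,
        h₃.blk_eq_zero (a := 8) (by decide) le_rfl] at h₁
      simp only [Matrix.zero_mul, Matrix.mul_zero, zero_add, add_zero] at h₁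
      rw [blk_sub_one _ (by decide), blk_sub_one _ (by decide), blk_sub_one _ (by decide),
        blk_sub_one _ (by decide)] at h₁
      exact congrFun (congrFun h₁ r) q
    · rw [Matrix.add_apply, map_add, evalAt_block_mul, evalAt_block_mul, ← Matrix.add_apply]
      have h₁ := (hc2 3 7 (by decide)).blk_eq_zero (a := 3) (b := 7) le_rfl le_rfl
      have h₂ := hc 3 4 (by decide)
      have h₃ := hc 7 7 (by decide)
      rw [blk_mul, sum_fin_nine, h₂.blk_eq_zero (b := 0) le_rfl (by decide),
        h₂.blk_eq_zero (b := 1) le_rfl (by decide), h₂.blk_eq_zero (b := 2) le_rfl (by decide),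
        h₂.blk_eq_zero (b := 3) le_rfl (by decide), h₂.blk_eq_zero (b := 4) le_rfl le_rfl,
        h₃.blk_eq_zero (a := 7) le_rfl le_rfl, h₃.blk_eq_zero (a := 8) (by decide) le_rfl] at h₁
      simp only [Matrix.zero_mul, Matrix.mul_zero, zero_add, add_zero] at h₁
      rw [blk_sub_one _ (by decide), blk_sub_one _ (by decide), blk_sub_one _ (by decide),
        blk_sub_one _ (by decide)] at h₁
      exact congrFun (congrFun h₁ r) q
    · have i1 : Subsingleton (Fin (size m k 1)) := inferInstanceAs (Subsingleton (Fin 1))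
      have i2 : Subsingleton (Fin (size m k 2)) := inferInstanceAs (Subsingleton (Fin 1))
      have i6 : Subsingleton (Fin (size m k 6)) := inferInstanceAs (Subsingleton (Fin 1))
      have i7 : Subsingleton (Fin (size m k 7)) := inferInstanceAs (Subsingleton (Fin 1))
      have e₁ := blk_conj_of_corner hb (H := mat h) (K := mat h⁻¹) (isUpper_mat _) (isUpper_mat _)
        (a := 1) (b := 2) (by decide)
      have e₂ := blk_conj_of_corner hb (H := mat h) (K := mat h⁻¹) (isUpper_mat _) (isUpper_mat _)
        (a := 6) (b := 7) (by decide)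
      rw [blk_diag_eq_one, blk_diag_eq_one, Matrix.one_mul, Matrix.mul_one, ← hY,
        blk_sub_one _ (by decide)] at e₁ e₂
      have c₁ : evalAt g (C m k 1 2 (0 : Fin 1) (0 : Fin 1)) = mat g idx1 idx2 :=
        evalAt_genericMat g _ _
      have c₂ : evalAt g (C m k 6 7 (0 : Fin 1) (0 : Fin 1)) = mat g idx6 idx7 :=
        evalAt_genericMat g _ _
      rw [map_sub, map_mul, map_mul, evalAt_C, evalAt_C, c₁, c₂, sub_eq_zero]
      have e₁' : mat g idx1 idx2 = X idx1 idx2 := congrFun (congrFun e₁ (0 : Fin 1)) (0 : Fin 1)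
      have e₂' : mat g idx6 idx7 = X idx6 idx7 := congrFun (congrFun e₂ (0 : Fin 1)) (0 : Fin 1)
      have := hx.rel
      rw [← e₁', ← e₂'] at this
      exact this

end Saturation

/-! ### Reaching nonzero pivots by perturbation inside the stabilizer. -/

section Density

variable {m k : ℕ} {γ₁ γ₂ : ℝ}

theorem IsStab.add {x y : Matrix (Idx m k) (Idx m k) ℝ} (hx : IsStab γ₁ γ₂ x)
    (hy : IsStab γ₁ γ₂ y) : IsStab γ₁ γ₂ (x + y) where
  blocks p q h := by rw [Matrix.add_apply, hx.blocks p q h, hy.blocks p q h, add_zero]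
  anti₁ r c h := by rw [Matrix.add_apply, hx.anti₁ r c h, hy.anti₁ r c h, add_zero]
  anti₂ r c h := by rw [Matrix.add_apply, hx.anti₂ r c h, hy.anti₂ r c h, add_zero]
  rel := by rw [Matrix.add_apply, Matrix.add_apply, mul_add, mul_add, hx.rel, hy.rel]

theorem IsStab.smul {x : Matrix (Idx m k) (Idx m k) ℝ} (hx : IsStab γ₁ γ₂ x) (c : ℝ) :
    IsStab γ₁ γ₂ (c • x) where
  blocks p q h := by rw [Matrix.smul_apply, hx.blocks p q h, smul_zero]
  anti₁ r c h := by rw [Matrix.smul_apply, hx.anti₁ r c h, smul_zero]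
  anti₂ r c h := by rw [Matrix.smul_apply, hx.anti₂ r c h, smul_zero]
  rel := by
    rw [Matrix.smul_apply, Matrix.smul_apply, mul_smul_comm, mul_smul_comm, hx.rel]

theorem IsStab.eq_zero {x : Matrix (Idx m k) (Idx m k) ℝ} (hx : IsStab γ₁ γ₂ x) (p q : Idx m k)
    (h : q ≤ p) : x p q = 0 := by
  refine hx.blocks p q fun hm => ?_
  have key : ∀ y ∈ stabBlocks, ¬ y.2 ≤ y.1 := by decide
  exact key _ hm (blkOf_mono h)

/-- The element of the Lie algebra of the stabilizer with given scalar in the pivot blocks of size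
one, and with units on the second diagonal of the pivot block of size `k`. -/
def pivotDir (γ₁ γ₂ : ℝ) : Matrix (Idx m k) (Idx m k) ℝ :=
  Matrix.single idx1 idx2 γ₂ + Matrix.single idx6 idx7 γ₁ +
    ∑ r : Fin k, Matrix.single (idx3 r) (idx5 (Fin.rev r)) 1

theorem pivotDir_apply (p q : Idx m k) : (pivotDir γ₁ γ₂ : Matrix (Idx m k) (Idx m k) ℝ) p q =
    (if idx1 = p ∧ idx2 = q then γ₂ else 0) + (if idx6 = p ∧ idx7 = q then γ₁ else 0) +
      ∑ r : Fin k, if idx3 r = p ∧ idx5 (Fin.rev r) = q then 1 else 0 := by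
  simp only [pivotDir, Matrix.add_apply, Matrix.sum_apply, Matrix.single_apply]

theorem pivotDir_idx12 : (pivotDir γ₁ γ₂ : Matrix (Idx m k) (Idx m k) ℝ) idx1 idx2 = γ₂ := by
  simp [pivotDir_apply, not_eq_of_blkOf]

theorem pivotDir_idx67 : (pivotDir γ₁ γ₂ : Matrix (Idx m k) (Idx m k) ℝ) idx6 idx7 = γ₁ := by
  simp [pivotDir_apply, not_eq_of_blkOf]

theorem pivotDir_idx35 (r c : Fin k) :
    (pivotDir γ₁ γ₂ : Matrix (Idx m k) (Idx m k) ℝ) (idx3 r) (idx5 c) =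
      if Fin.rev r = c then 1 else 0 := by
  simp [pivotDir_apply, not_eq_of_blkOf, ite_and]

/-- The scalars are placed crosswise, `γ₂` in block (1,2) and `γ₁` in block (6,7), so that the
linear relation reads `γ₁ γ₂ = γ₂ γ₁`. -/
theorem isStab_pivotDir : IsStab γ₁ γ₂ (pivotDir γ₁ γ₂ : Matrix (Idx m k) (Idx m k) ℝ) where
  blocks p q h := by
    rw [pivotDir_apply, if_neg, if_neg, Finset.sum_eq_zero, add_zero, add_zero]
    · intro r _
      refine if_neg ?_
      rintro ⟨rfl, rfl⟩
      exact h (by simp [stabBlocks])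
    · rintro ⟨rfl, rfl⟩
      exact h (by simp [stabBlocks])
    · rintro ⟨rfl, rfl⟩
      exact h (by simp [stabBlocks])
  anti₁ r c _ := by simp [pivotDir_apply, not_eq_of_blkOf]
  anti₂ r c h := by rw [pivotDir_idx35, if_neg (Ne.symm h)]
  rel := by rw [pivotDir_idx12, pivotDir_idx67, mul_comm]

theorem det_ne_zero_of_anti {n : ℕ} {A : Matrix (Fin n) (Fin n) ℝ}
    (h₀ : ∀ r c, c ≠ Fin.rev r → A r c = 0) (h₁ : ∀ r, A r (Fin.rev r) ≠ 0) : A.det ≠ 0 := by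
  have e : A.submatrix id Fin.revPerm = Matrix.diagonal fun r => A r (Fin.rev r) := by
    ext r c
    rcases eq_or_ne r c with rfl | h
    · simp
    · rw [Matrix.diagonal_apply_ne _ h]
      exact h₀ _ _ fun h' => h (Fin.rev_injective h').symm
  intro hA
  have h := congrArg Matrix.det e
  rw [Matrix.det_permute', hA, mul_zero, Matrix.det_diagonal] at h
  exact Finset.prod_ne_zero_iff.2 (fun r _ => h₁ r) h.symm

theorem pivot_corner (s : Fin 3) : ∀ y ∈ stabBlocks, rowBlk s ≤ y.1 → y.2 ≤ colBlk s →
    y = (rowBlk s, colBlk s) := by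
  revert s
  decide

theorem rowBlk_ne_colBlk (s t : Fin 3) : rowBlk s ≠ colBlk t := by
  revert s t
  decide

theorem submatrix_mul_mul {α β : Type} [Fintype α] [Fintype β] (A : Matrix α α ℝ)
    (B : Matrix α β ℝ) (D : Matrix β β ℝ) (e : α ≃ β) : (A * B * D).submatrix id e =
      A * B.submatrix id e * D.submatrix e e :=
  (Matrix.submatrix_mul_equiv (A * B) D id e e).symm

/-- Conjugation does not change the pivot minors of an element of the stabilizer. -/
theorem det_pivot_conj {h x : UT (Idx m k)} (hx : IsStab γ₁ γ₂ (mat x - 1)) (s : Fin 3) :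
    ((blk (mat (h * x * h⁻¹)) (rowBlk s) (colBlk s)).submatrix id
      (Fin.cast (size_rowBlk m k s))).det =
    ((blk (mat x - 1) (rowBlk s) (colBlk s)).submatrix id (Fin.cast (size_rowBlk m k s))).det := by
  have e := blk_conj_of_corner hx.blocks (isUpper_mat h) (isUpper_mat h⁻¹) (pivot_corner s)
  rw [← blk_sub_one _ (rowBlk_ne_colBlk s s)]
  have e' : blk (mat (h * x * h⁻¹) - 1) (rowBlk s) (colBlk s) = _ :=
    (congrArg (fun M => blk M (rowBlk s) (colBlk s)) (mat_conj_sub_one h x)).trans e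
  rw [e']
  have e₂ : (blk (mat h) (rowBlk s) (rowBlk s) * blk (mat x - 1) (rowBlk s) (colBlk s) *
      blk (mat h⁻¹) (colBlk s) (colBlk s)).submatrix id (Fin.cast (size_rowBlk m k s)) =
      blk (mat h) (rowBlk s) (rowBlk s) *
        (blk (mat x - 1) (rowBlk s) (colBlk s)).submatrix id (finCongr (size_rowBlk m k s)) *
        (blk (mat h⁻¹) (colBlk s) (colBlk s)).submatrix (finCongr (size_rowBlk m k s))
          (finCongr (size_rowBlk m k s)) :=
    submatrix_mul_mul _ _ _ (finCongr (size_rowBlk m k s))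
  rw [e₂, Matrix.det_mul, Matrix.det_mul, Matrix.det_submatrix_equiv_self, det_blk_diag,
    det_blk_diag, one_mul, mul_one]
  rfl

theorem evalAt_d₁_conj_ne_zero {h x : UT (Idx m k)} (hx : IsStab γ₁ γ₂ (mat x - 1))
    (h₁ : (mat x - 1) idx1 idx2 ≠ 0) (h₂ : (mat x - 1) idx6 idx7 ≠ 0)
    (h₃ : ∀ r : Fin k, (mat x - 1) (idx3 r) (idx5 (Fin.rev r)) ≠ 0) :
    evalAt (h * x * h⁻¹) (d₁ m k) ≠ 0 := by
  rw [evalAt_d₁_ne_zero_iff]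
  intro s
  rw [det_pivot_conj hx]
  fin_cases s
  · refine ne_of_eq_of_ne (Matrix.det_fin_one _) ?_
    exact h₁
  · exact det_ne_zero_of_anti (n := k) (fun r c hrc => hx.anti₂ r c hrc) h₃
  · refine ne_of_eq_of_ne (Matrix.det_fin_one _) ?_
    exact h₂

theorem eventually_add_mul_ne_zero (c : ℝ) {d : ℝ} (hd : d ≠ 0) :
    ∀ᶠ ε in nhdsWithin (0 : ℝ) {0}ᶜ, c + ε * d ≠ 0 := by
  rcases eq_or_ne c 0 with rfl | hc
  · filter_upwards [self_mem_nhdsWithin] with ε hε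
    rw [zero_add]
    exact mul_ne_zero hε hd
  · refine nhdsWithin_le_nhds ?_
    have : Continuous fun ε : ℝ => c + ε * d := by fun_prop
    exact this.continuousAt.eventually_ne (by simpa using hc)

/-- The stabilizer condition is linear in `x - 1`, so one may move along `pivotDir`. Every entry on
which `d₁` depends is then affine in `ε` with nonzero slope, hence nonzero for all small `ε ≠ 0`. -/
theorem conj_stab_mem_closure_zeroSet (hγ₁ : γ₁ ≠ 0) (hγ₂ : γ₂ ≠ 0) {h x : UT (Idx m k)}
    (hx : IsStab γ₁ γ₂ (mat x - 1)) :
    h * x * h⁻¹ ∈ closure (zeroSet (d₁ m k) (I' m k γ₁ γ₂)) := by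
  have hs : ∀ ε : ℝ, IsStab γ₁ γ₂ (mat x - 1 + ε • pivotDir γ₁ γ₂) := fun ε =>
    hx.add (isStab_pivotDir.smul ε)
  let F : ℝ → UT (Idx m k) := fun ε => oneAdd _ (hs ε).eq_zero
  have hF : ∀ ε, mat (F ε) - 1 = mat x - 1 + ε • pivotDir γ₁ γ₂ := fun ε =>
    mat_oneAdd_sub_one _ _
  have hF0 : F 0 = x := oneAdd_eq (hs 0).eq_zero (by rw [zero_smul, add_zero]; rfl)
  have hFc : Continuous F := by
    rw [isInducing_mat.continuous_iff]
    have : Continuous fun ε : ℝ => 1 + (mat x - 1 + ε • pivotDir γ₁ γ₂) := by fun_prop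
    exact this
  have hlim : Filter.Tendsto (fun ε => h * F ε * h⁻¹) (nhdsWithin (0 : ℝ) {0}ᶜ)
      (nhds (h * x * h⁻¹)) := by
    have : Continuous fun ε => h * F ε * h⁻¹ := (continuous_const.mul hFc).mul continuous_const
    have h0 := this.tendsto 0
    rw [hF0] at h0
    exact h0.mono_left nhdsWithin_le_nhds
  refine mem_closure_of_tendsto hlim ?_
  filter_upwards [eventually_add_mul_ne_zero ((mat x - 1) idx1 idx2) hγ₂,
    eventually_add_mul_ne_zero ((mat x - 1) idx6 idx7) hγ₁,
    Filter.eventually_all.2 fun r : Fin k =>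
      eventually_add_mul_ne_zero ((mat x - 1) (idx3 r) (idx5 (Fin.rev r))) one_ne_zero]
    with ε h₁ h₂ h₃
  have hst : IsStab γ₁ γ₂ (mat (F ε) - 1) := by rw [hF]; exact hs ε
  refine conj_stab_mem_zeroSet hst (evalAt_d₁_conj_ne_zero hst ?_ ?_ fun r => ?_)
  · rw [hF, Matrix.add_apply, Matrix.smul_apply, pivotDir_idx12]
    exact h₁
  · rw [hF, Matrix.add_apply, Matrix.smul_apply, pivotDir_idx67]
    exact h₂
  · rw [hF, Matrix.add_apply, Matrix.smul_apply, pivotDir_idx35, if_pos rfl]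
    exact h₃ r

end Density

/-! ### Density of the big Bruhat cell. -/

section BigCell

/-- The matrices `A` with `A V = U D`, where `U`, `V` are upper unitriangular and `D` has its
support on the second diagonal. -/
def bigCell (n : ℕ) : Set (Matrix (Fin n) (Fin n) ℝ) :=
  {A | ∃ U V D : Matrix (Fin n) (Fin n) ℝ, ((∀ i, U i i = 1) ∧ ∀ i j, j < i → U i j = 0) ∧
    ((∀ i, V i i = 1) ∧ ∀ i j, j < i → V i j = 0) ∧ (∀ r c, c ≠ Fin.rev r → D r c = 0) ∧
    A * V = U * D}

/-- The matrices `A` with `A V = L D`, where `L` is lower and `V` is upper unitriangular and `D` is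
diagonal. -/
def lowerCell (n : ℕ) : Set (Matrix (Fin n) (Fin n) ℝ) :=
  {A | ∃ (L V : Matrix (Fin n) (Fin n) ℝ) (d : Fin n → ℝ),
    ((∀ i, L i i = 1) ∧ ∀ i j, i < j → L i j = 0) ∧
    ((∀ i, V i i = 1) ∧ ∀ i j, j < i → V i j = 0) ∧ A * V = L * Matrix.diagonal d}

/-- The matrix with corner entry `d`, first row `b`, first column `c` and Schur complement `B`. -/
def schurMat {n : ℕ} (d : ℝ) (b c : Fin n → ℝ) (B : Matrix (Fin n) (Fin n) ℝ) :
    Matrix (Fin (n + 1)) (Fin (n + 1)) ℝ :=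
  Matrix.of (Fin.cons (Fin.cons d b) fun i => Fin.cons (c i) fun j => B i j + c i * b j / d)

theorem schurMat_mem_lowerCell {n : ℕ} {d : ℝ} (hd : d ≠ 0) (b c : Fin n → ℝ)
    {B : Matrix (Fin n) (Fin n) ℝ} (hB : B ∈ lowerCell n) :
    schurMat d b c B ∈ lowerCell (n + 1) := by
  obtain ⟨L, V, e, ⟨hL₁, hL₀⟩, ⟨hV₁, hV₀⟩, h⟩ := hB
  -- One step of block Gaussian elimination: the first row of the new `V` is chosen to clear the
  -- first row of the product outside the corner, and the Schur complement is factored by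
  -- hypothesis.
  refine ⟨Matrix.of (Fin.cons (Fin.cons 1 0) fun i => Fin.cons (c i / d) (L i)),
    Matrix.of (Fin.cons (Fin.cons 1 fun j => -(∑ l, b l * V l j) / d) fun i => Fin.cons 0 (V i)),
    Fin.cons d e, ⟨fun i => ?_, fun i j => ?_⟩, ⟨fun i => ?_, fun i j => ?_⟩, ?_⟩
  · refine Fin.cases ?_ (fun i => ?_) i <;> simp [hL₁]
  · refine Fin.cases ?_ (fun i => ?_) i <;> refine Fin.cases ?_ (fun j => ?_) j
    · simp
    · simp
    · simp
    · simpa using hL₀ i j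
  · refine Fin.cases ?_ (fun i => ?_) i <;> simp [hV₁]
  · refine Fin.cases ?_ (fun i => ?_) i <;> refine Fin.cases ?_ (fun j => ?_) j
    · simp
    · simp
    · simp
    · simpa using hV₀ i j
  · ext i j
    have h' : ∀ i j, ∑ l, B i l * V l j = L i j * e j := fun i j => by
      have := congrFun (congrFun h i) j
      rwa [Matrix.mul_diagonal, Matrix.mul_apply] at this
    rw [Matrix.mul_diagonal, Matrix.mul_apply, Fin.sum_univ_succ]
    refine Fin.cases ?_ (fun i => ?_) i <;> refine Fin.cases ?_ (fun j => ?_) j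
    · simp [schurMat]
    · simp [schurMat]
      field_simp
      ring
    · simp [schurMat]
      field_simp
    · simp only [schurMat, Matrix.of_apply, Fin.cons_succ, Fin.cons_zero, ← h', add_mul,
        Finset.sum_add_distrib]
      have : ∑ l, c i * b l / d * V l j = c i * (∑ l, b l * V l j) / d := by
        rw [Finset.mul_sum, Finset.sum_div]
        exact Finset.sum_congr rfl fun l _ => by ring
      rw [this]
      ring

theorem continuous_schurMat {n : ℕ} (d : ℝ) (b c : Fin n → ℝ) :
    Continuous (schurMat d b c) := by
  refine continuous_pi fun i => continuous_pi fun j => ?_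
  refine Fin.cases ?_ (fun i => ?_) i <;> refine Fin.cases ?_ (fun j => ?_) j <;>
    simp only [schurMat, Matrix.of_apply, Fin.cons_succ, Fin.cons_zero] <;> fun_prop

/-- By induction on the size. If the corner entry is nonzero, only the Schur complement is
approximated, with corner, first row and first column kept fixed; a zero corner entry is first
perturbed, whence the double closure. -/
theorem dense_lowerCell (n : ℕ) : Dense (lowerCell n) := by
  induction n with
  | zero =>
    intro A
    exact subset_closure ⟨1, 1, 0, ⟨fun i => i.elim0, fun i => i.elim0⟩,
      ⟨fun i => i.elim0, fun i => i.elim0⟩, Subsingleton.elim _ _⟩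
  | succ n ih =>
    have key : ∀ A : Matrix (Fin (n + 1)) (Fin (n + 1)) ℝ, A 0 0 ≠ 0 →
        A ∈ closure (lowerCell (n + 1)) := by
      intro A hA
      let b : Fin n → ℝ := fun j => A 0 j.succ
      let c : Fin n → ℝ := fun i => A i.succ 0
      let B : Matrix (Fin n) (Fin n) ℝ := Matrix.of fun i j =>
        A i.succ j.succ - c i * b j / A 0 0
      have e : schurMat (A 0 0) b c B = A := by
        ext i j
        refine Fin.cases ?_ (fun i => ?_) i <;> refine Fin.cases ?_ (fun j => ?_) j <;>
          simp [schurMat, B, b, c]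
      rw [← e]
      exact map_mem_closure (continuous_schurMat _ _ _) (ih B) fun B' hB' =>
        schurMat_mem_lowerCell hA _ _ hB'
    intro A
    rw [← closure_closure]
    have hlim : Filter.Tendsto (fun ε : ℝ => A + ε • Matrix.single 0 0 1)
        (nhdsWithin (0 : ℝ) {0}ᶜ) (nhds A) := by
      have : Continuous fun ε : ℝ => A + ε • Matrix.single 0 0 1 := by fun_prop
      have h0 := this.tendsto 0
      rw [zero_smul, add_zero] at h0
      exact h0.mono_left nhdsWithin_le_nhds
    refine mem_closure_of_tendsto hlim ?_
    filter_upwards [eventually_add_mul_ne_zero (A 0 0) one_ne_zero] with ε hε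
    refine key _ ?_
    simpa using hε

/-- Reversing the order of the rows exchanges the two cells: conjugated by the reversal, a lower
unitriangular matrix becomes upper unitriangular, and a diagonal matrix with reversed rows is
supported on the second diagonal. -/
theorem dense_bigCell (n : ℕ) : Dense (bigCell n) := by
  intro A
  have hc : Continuous fun B : Matrix (Fin n) (Fin n) ℝ => B.submatrix Fin.rev id :=
    continuous_pi fun i => continuous_pi fun j => continuous_apply_apply _ _
  have h := map_mem_closure hc (dense_lowerCell n (A.submatrix Fin.rev id)) (t := bigCell n) ?_
  · simpa [Fin.rev_involutive.comp_self] using h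
  rintro B ⟨L, V, d, ⟨hL₁, hL₀⟩, hV, h⟩
  refine ⟨L.submatrix Fin.rev Fin.rev, V, (Matrix.diagonal d).submatrix Fin.rev id,
    ⟨fun i => hL₁ _, fun i j hij => hL₀ _ _ (Fin.rev_lt_rev.2 hij)⟩, hV, fun r c hrc => ?_, ?_⟩
  · exact Matrix.diagonal_apply_ne _ (Ne.symm hrc)
  · have e₁ := congrArg (fun M => M.submatrix Fin.rev id) h
    have e₂ : (L * Matrix.diagonal d).submatrix Fin.rev id =
        L.submatrix Fin.rev Fin.revPerm * (Matrix.diagonal d).submatrix Fin.revPerm id :=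
      (Matrix.submatrix_mul_equiv _ _ _ _ _).symm
    exact e₁.trans e₂

end BigCell

/-! ### Block inclusions and block column calculus. -/

section Inclusions

variable (m k : ℕ)

/-- The columns of the identity matrix that belong to a block. -/
def inc (b : Fin 9) : Matrix (Idx m k) (Fin (size m k b)) ℝ :=
  (1 : Matrix (Idx m k) (Idx m k) ℝ).submatrix id (pos b)

variable {m k}

theorem mul_inc (M : Matrix (Idx m k) (Idx m k) ℝ) (b : Fin 9) :
    M * inc m k b = M.submatrix id (pos b) := by
  ext p q
  simp [inc, Matrix.mul_apply, Matrix.one_apply]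

theorem transpose_inc_mul {β : Type} (M : Matrix (Idx m k) β ℝ) (b : Fin 9) :
    (inc m k b)ᵀ * M = M.submatrix (pos b) id := by
  ext p q
  simp [inc, Matrix.mul_apply, Matrix.one_apply, eq_comm]

theorem transpose_inc_mul_inc_self (b : Fin 9) : (inc m k b)ᵀ * inc m k b = 1 := by
  rw [transpose_inc_mul]
  ext r q
  simp [inc, Matrix.one_apply, (pos_injective b).eq_iff]

theorem transpose_inc_mul_inc_of_ne (a b : Fin 9) (h : decide (a = b) = false) :
    (inc m k a)ᵀ * inc m k b = 0 := by
  rw [transpose_inc_mul]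
  ext r q
  exact Matrix.one_apply_ne (ne_of_blkOf_ne (of_decide_eq_false h))

theorem sum_inc_mul_transpose : ∑ b, inc m k b * (inc m k b)ᵀ = 1 := by
  ext p q
  rw [Matrix.sum_apply]
  have h := sum_idx fun s : Idx m k => (1 : Matrix (Idx m k) (Idx m k) ℝ) p s *
    (1 : Matrix (Idx m k) (Idx m k) ℝ) q s
  have e : ∑ s : Idx m k, (1 : Matrix (Idx m k) (Idx m k) ℝ) p s *
    (1 : Matrix (Idx m k) (Idx m k) ℝ) q s = (1 : Matrix (Idx m k) (Idx m k) ℝ) p q := by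
    simp [Matrix.one_apply]
  rw [← e, h]
  rfl

/-- The conjugacies below are verified in this way, one block column at a time. -/
theorem ext_of_mul_inc {M N : Matrix (Idx m k) (Idx m k) ℝ}
    (h : ∀ b, M * inc m k b = N * inc m k b) : M = N := by
  rw [← Matrix.mul_one M, ← Matrix.mul_one N, ← sum_inc_mul_transpose, Matrix.mul_sum,
    Matrix.mul_sum]
  refine Finset.sum_congr rfl fun b _ => ?_
  rw [← Matrix.mul_assoc, ← Matrix.mul_assoc, h]

theorem mul_inc_eq_sum (M : Matrix (Idx m k) (Idx m k) ℝ) (b : Fin 9) :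
    M * inc m k b = ∑ a, inc m k a * blk M a b := by
  have h : ∀ a, blk M a b = (inc m k a)ᵀ * (M * inc m k b) := fun a => by
    rw [mul_inc, transpose_inc_mul]
    rfl
  simp only [h, ← Matrix.mul_assoc, ← Matrix.sum_mul]
  rw [sum_inc_mul_transpose, Matrix.one_mul]

theorem inc_mul_apply {a b : Fin 9} (N : Matrix (Fin (size m k a)) (Fin (size m k b)) ℝ)
    (r : Fin (size m k a)) (q : Fin (size m k b)) :
    (inc m k a * N * (inc m k b)ᵀ) (pos a r) (pos b q) = N r q := by
  have h : (inc m k a)ᵀ * (inc m k a * N * (inc m k b)ᵀ) * inc m k b = N := by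
    rw [Matrix.mul_assoc, Matrix.mul_assoc, transpose_inc_mul_inc_self, Matrix.mul_one,
      ← Matrix.mul_assoc, transpose_inc_mul_inc_self, Matrix.one_mul]
  rw [transpose_inc_mul] at h
  have h' := congrFun (congrFun h r) q
  rw [← h']
  simp [inc, Matrix.mul_apply, Matrix.one_apply]

theorem inc_apply_of_ne {b : Fin 9} {p : Idx m k} (h : blkOf p ≠ b) (r : Fin (size m k b)) :
    inc m k b p r = 0 :=
  Matrix.one_apply_ne (ne_of_blkOf_ne h)

theorem inc_mul_apply_of_ne {a b : Fin 9} (N : Matrix (Fin (size m k a)) (Fin (size m k b)) ℝ)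
    (p q : Idx m k) (h : (blkOf p, blkOf q) ≠ (a, b)) :
    (inc m k a * N * (inc m k b)ᵀ) p q = 0 := by
  by_cases ha : blkOf p = a
  · have hb : blkOf q ≠ b := fun hb => h (by rw [ha, hb])
    rw [Matrix.mul_apply]
    refine Finset.sum_eq_zero fun r _ => ?_
    rw [Matrix.transpose_apply, inc_apply_of_ne hb, mul_zero]
  · rw [Matrix.mul_assoc, Matrix.mul_apply]
    refine Finset.sum_eq_zero fun r _ => ?_
    rw [inc_apply_of_ne ha, zero_mul]

theorem inc_mul_strict {a b : Fin 9} (hab : a < b)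
    (N : Matrix (Fin (size m k a)) (Fin (size m k b)) ℝ) (p q : Idx m k) (h : q ≤ p) :
    (inc m k a * N * (inc m k b)ᵀ) p q = 0 := by
  refine inc_mul_apply_of_ne N p q fun e => ?_
  have h₁ : blkOf p = a := congrArg Prod.fst e
  have h₂ : blkOf q = b := congrArg Prod.snd e
  have h₃ := blkOf_mono h
  rw [h₁, h₂] at h₃
  exact absurd hab (not_lt.2 h₃)

theorem inc_mul_strict_self {a : Fin 9} (N : Matrix (Fin (size m k a)) (Fin (size m k a)) ℝ)
    (hN : ∀ i j, j ≤ i → N i j = 0) (p q : Idx m k) (h : q ≤ p) :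
    (inc m k a * N * (inc m k a)ᵀ) p q = 0 := by
  by_cases e : (blkOf p, blkOf q) = (a, a)
  · obtain ⟨r, hr⟩ := pos_surj p
    obtain ⟨c, hc⟩ := pos_surj q
    obtain ⟨h₁, h₂⟩ := Prod.mk.inj e
    generalize blkOf p = a' at *
    generalize blkOf q = b' at *
    subst h₁ h₂ hr hc
    rw [inc_mul_apply]
    exact hN r c (not_lt.1 fun h' => absurd (pos_lt_pos.2 h') (not_lt.2 h))
  · exact inc_mul_apply_of_ne N p q e

end Inclusions

/-! ### The normal form with two free square blocks. -/

section NormalForm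

variable {m k : ℕ} {γ₁ γ₂ : ℝ}

/-- The matrix with given blocks in the places of the blocks of the stabilizer, with arbitrary
square blocks instead of those with entries on the second diagonal. -/
def stabMat (p : Matrix (Fin (size m k 1)) (Fin (size m k 2)) ℝ)
    (w : Matrix (Fin (size m k 6)) (Fin (size m k 7)) ℝ)
    (s : Matrix (Fin (size m k 1)) (Fin (size m k 6)) ℝ)
    (A : Matrix (Fin (size m k 3)) (Fin (size m k 5)) ℝ)
    (T : Matrix (Fin (size m k 0)) (Fin (size m k 8)) ℝ) : Matrix (Idx m k) (Idx m k) ℝ :=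
  inc m k 1 * p * (inc m k 2)ᵀ + inc m k 6 * w * (inc m k 7)ᵀ + inc m k 1 * s * (inc m k 6)ᵀ +
    inc m k 3 * A * (inc m k 5)ᵀ + inc m k 0 * T * (inc m k 8)ᵀ

theorem stabMat_eq_zero (p : Matrix (Fin (size m k 1)) (Fin (size m k 2)) ℝ)
    (w : Matrix (Fin (size m k 6)) (Fin (size m k 7)) ℝ)
    (s : Matrix (Fin (size m k 1)) (Fin (size m k 6)) ℝ)
    (A : Matrix (Fin (size m k 3)) (Fin (size m k 5)) ℝ)
    (T : Matrix (Fin (size m k 0)) (Fin (size m k 8)) ℝ) (x y : Idx m k) (h : y ≤ x) :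
    stabMat p w s A T x y = 0 := by
  simp only [stabMat, Matrix.add_apply]
  rw [inc_mul_strict (by decide) p x y h, inc_mul_strict (by decide) w x y h,
    inc_mul_strict (by decide) s x y h, inc_mul_strict (by decide) A x y h,
    inc_mul_strict (by decide) T x y h]
  simp

theorem isStab_stabMat (p : Matrix (Fin (size m k 1)) (Fin (size m k 2)) ℝ)
    (w : Matrix (Fin (size m k 6)) (Fin (size m k 7)) ℝ)
    (s : Matrix (Fin (size m k 1)) (Fin (size m k 6)) ℝ)
    (A : Matrix (Fin (size m k 3)) (Fin (size m k 5)) ℝ)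
    (T : Matrix (Fin (size m k 0)) (Fin (size m k 8)) ℝ)
    (hA : ∀ r c : Fin k, c ≠ Fin.rev r → A r c = 0)
    (hT : ∀ r c : Fin m, c ≠ Fin.rev r → T r c = 0)
    (hpw : γ₁ * p (0 : Fin 1) (0 : Fin 1) = γ₂ * w (0 : Fin 1) (0 : Fin 1)) :
    IsStab γ₁ γ₂ (stabMat p w s A T) := by
  have hz : ∀ x y : Idx m k, ∀ a b : Fin 9, decide ((blkOf x, blkOf y) = (a, b)) = false →
      ∀ N : Matrix (Fin (size m k a)) (Fin (size m k b)) ℝ,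
      (inc m k a * N * (inc m k b)ᵀ) x y = 0 := fun x y a b h N =>
    inc_mul_apply_of_ne N x y (of_decide_eq_false h)
  refine ⟨fun x y h => ?_, fun r c h => ?_, fun r c h => ?_, ?_⟩
  · have hne : ∀ z ∈ stabBlocks, (blkOf x, blkOf y) ≠ z := by
      rintro z hz rfl
      exact h hz
    simp only [stabMat, Matrix.add_apply]
    rw [inc_mul_apply_of_ne p x y (hne _ (by decide)),
      inc_mul_apply_of_ne w x y (hne _ (by decide)),
      inc_mul_apply_of_ne s x y (hne _ (by decide)), inc_mul_apply_of_ne A x y (hne _ (by decide)),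
      inc_mul_apply_of_ne T x y (hne _ (by decide))]
    simp
  · simp only [stabMat, Matrix.add_apply]
    rw [hz _ _ _ _ rfl, hz _ _ _ _ rfl, hz _ _ _ _ rfl, hz _ _ _ _ rfl]
    have : (inc m k 0 * T * (inc m k 8)ᵀ) (idx0 r) (idx8 c) = T r c := inc_mul_apply T r c
    rw [this, hT r c h]
    simp
  · simp only [stabMat, Matrix.add_apply]
    rw [hz _ _ _ _ rfl, hz _ _ _ _ rfl, hz _ _ _ _ rfl, hz _ _ 0 8 rfl]
    have : (inc m k 3 * A * (inc m k 5)ᵀ) (idx3 r) (idx5 c) = A r c := inc_mul_apply A r c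
    rw [this, hA r c h]
    simp
  · simp only [stabMat, Matrix.add_apply]
    have h₁ : (inc m k 1 * p * (inc m k 2)ᵀ) idx1 idx2 = p (0 : Fin 1) (0 : Fin 1) :=
      inc_mul_apply p _ _
    have h₂ : (inc m k 6 * w * (inc m k 7)ᵀ) idx6 idx7 = w (0 : Fin 1) (0 : Fin 1) :=
      inc_mul_apply w _ _
    rw [h₁, h₂, hz _ _ 6 7 rfl, hz _ _ 1 6 rfl, hz _ _ 3 5 rfl, hz _ _ 0 8 rfl, hz _ _ 1 2 rfl,
      hz _ _ 1 6 rfl, hz _ _ 3 5 rfl, hz _ _ 0 8 rfl]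
    simpa using hpw

/-- The columns of `stabMat`. -/
theorem stabMat_mul_inc (p : Matrix (Fin (size m k 1)) (Fin (size m k 2)) ℝ)
    (w : Matrix (Fin (size m k 6)) (Fin (size m k 7)) ℝ)
    (s : Matrix (Fin (size m k 1)) (Fin (size m k 6)) ℝ)
    (A : Matrix (Fin (size m k 3)) (Fin (size m k 5)) ℝ)
    (T : Matrix (Fin (size m k 0)) (Fin (size m k 8)) ℝ) :
    stabMat p w s A T * inc m k 0 = 0 ∧ stabMat p w s A T * inc m k 1 = 0 ∧
    stabMat p w s A T * inc m k 2 = inc m k 1 * p ∧ stabMat p w s A T * inc m k 3 = 0 ∧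
    stabMat p w s A T * inc m k 4 = 0 ∧ stabMat p w s A T * inc m k 5 = inc m k 3 * A ∧
    stabMat p w s A T * inc m k 6 = inc m k 1 * s ∧
    stabMat p w s A T * inc m k 7 = inc m k 6 * w ∧
    stabMat p w s A T * inc m k 8 = inc m k 0 * T := by
  simp [stabMat, Matrix.add_mul, Matrix.mul_assoc, transpose_inc_mul_inc_self,
    transpose_inc_mul_inc_of_ne]

end NormalForm

/-! ### Approximating the normal form by conjugates of the stabilizer. -/

section Approximation

variable {m k : ℕ} {γ₁ γ₂ : ℝ}

/-- The block diagonal unitriangular element with given blocks in the places `0, 3, 5, 8`. -/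
theorem exists_blockDiag (U₀ : Matrix (Fin (size m k 0)) (Fin (size m k 0)) ℝ)
    (U₃ : Matrix (Fin (size m k 3)) (Fin (size m k 3)) ℝ)
    (U₅ : Matrix (Fin (size m k 5)) (Fin (size m k 5)) ℝ)
    (U₈ : Matrix (Fin (size m k 8)) (Fin (size m k 8)) ℝ)
    (h₀ : (∀ i, U₀ i i = 1) ∧ ∀ i j, j < i → U₀ i j = 0)
    (h₃ : (∀ i, U₃ i i = 1) ∧ ∀ i j, j < i → U₃ i j = 0)
    (h₅ : (∀ i, U₅ i i = 1) ∧ ∀ i j, j < i → U₅ i j = 0)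
    (h₈ : (∀ i, U₈ i i = 1) ∧ ∀ i j, j < i → U₈ i j = 0) :
    ∃ u : UT (Idx m k), mat u * inc m k 0 = inc m k 0 * U₀ ∧ mat u * inc m k 1 = inc m k 1 ∧
      mat u * inc m k 2 = inc m k 2 ∧ mat u * inc m k 3 = inc m k 3 * U₃ ∧
      mat u * inc m k 4 = inc m k 4 ∧ mat u * inc m k 5 = inc m k 5 * U₅ ∧
      mat u * inc m k 6 = inc m k 6 ∧ mat u * inc m k 7 = inc m k 7 ∧
      mat u * inc m k 8 = inc m k 8 * U₈ := by
  have hs : ∀ {n : ℕ} {U : Matrix (Fin n) (Fin n) ℝ},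
      ((∀ i, U i i = 1) ∧ ∀ i j, j < i → U i j = 0) → ∀ i j, j ≤ i → (U - 1) i j = 0 := by
    rintro n U ⟨h₁, h₀⟩ i j hij
    rcases hij.eq_or_lt with rfl | hij
    · simp [h₁]
    · rw [Matrix.sub_apply, h₀ i j hij, Matrix.one_apply_ne hij.ne', sub_zero]
  let N : Matrix (Idx m k) (Idx m k) ℝ := inc m k 0 * (U₀ - 1) * (inc m k 0)ᵀ +
    inc m k 3 * (U₃ - 1) * (inc m k 3)ᵀ + inc m k 5 * (U₅ - 1) * (inc m k 5)ᵀ +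
    inc m k 8 * (U₈ - 1) * (inc m k 8)ᵀ
  have hN : ∀ p q, q ≤ p → N p q = 0 := by
    intro p q h
    simp only [N, Matrix.add_apply]
    rw [inc_mul_strict_self _ (hs h₀) p q h, inc_mul_strict_self _ (hs h₃) p q h,
      inc_mul_strict_self _ (hs h₅) p q h, inc_mul_strict_self _ (hs h₈) p q h]
    simp
  have hm : mat (oneAdd N hN) = 1 + N := rfl
  refine ⟨oneAdd N hN, ?_⟩
  rw [hm]
  simp [N, Matrix.add_mul, Matrix.mul_assoc, transpose_inc_mul_inc_self,
    transpose_inc_mul_inc_of_ne, Matrix.mul_sub]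

/-- Conjugation by a block diagonal element acts on the two free blocks of `stabMat`. -/
theorem exists_conj_stabMat (p : Matrix (Fin (size m k 1)) (Fin (size m k 2)) ℝ)
    (w : Matrix (Fin (size m k 6)) (Fin (size m k 7)) ℝ)
    (s : Matrix (Fin (size m k 1)) (Fin (size m k 6)) ℝ)
    {A D : Matrix (Fin (size m k 3)) (Fin (size m k 5)) ℝ}
    {T E : Matrix (Fin (size m k 0)) (Fin (size m k 8)) ℝ}
    {U : Matrix (Fin (size m k 3)) (Fin (size m k 3)) ℝ}
    {V : Matrix (Fin (size m k 5)) (Fin (size m k 5)) ℝ}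
    {U' : Matrix (Fin (size m k 0)) (Fin (size m k 0)) ℝ}
    {V' : Matrix (Fin (size m k 8)) (Fin (size m k 8)) ℝ}
    (hU : (∀ i, U i i = 1) ∧ ∀ i j, j < i → U i j = 0)
    (hV : (∀ i, V i i = 1) ∧ ∀ i j, j < i → V i j = 0)
    (hU' : (∀ i, U' i i = 1) ∧ ∀ i j, j < i → U' i j = 0)
    (hV' : (∀ i, V' i i = 1) ∧ ∀ i j, j < i → V' i j = 0)
    (hA : A * V = U * D) (hT : T * V' = U' * E) :
    ∃ u : UT (Idx m k), oneAdd (stabMat p w s A T) (stabMat_eq_zero p w s A T) =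
      u * oneAdd (stabMat p w s D E) (stabMat_eq_zero p w s D E) * u⁻¹ := by
  obtain ⟨u, u0, u1, u2, u3, u4, u5, u6, u7, u8⟩ :=
    exists_blockDiag (m := m) (k := k) U' U V V' hU' hU hV hV'
  -- Only the block columns 5 and 8 see the free blocks; there the identity is `A V = U D` and `T V'
  -- = U' E`.
  have key : stabMat p w s A T * mat u = mat u * stabMat p w s D E := by
    obtain ⟨a0, a1, a2, a3, a4, a5, a6, a7, a8⟩ := stabMat_mul_inc p w s A T
    obtain ⟨b0, b1, b2, b3, b4, b5, b6, b7, b8⟩ := stabMat_mul_inc p w s D E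
    refine ext_of_mul_inc fun b => ?_
    rw [Matrix.mul_assoc, Matrix.mul_assoc]
    fin_cases b
    · change _ * (_ * inc m k 0) = _ * (_ * inc m k 0)
      rw [u0, b0, ← Matrix.mul_assoc, a0, Matrix.zero_mul, Matrix.mul_zero]
    · change _ * (_ * inc m k 1) = _ * (_ * inc m k 1)
      rw [u1, b1, a1, Matrix.mul_zero]
    · change _ * (_ * inc m k 2) = _ * (_ * inc m k 2)
      rw [u2, b2, a2, ← Matrix.mul_assoc, u1]
    · change _ * (_ * inc m k 3) = _ * (_ * inc m k 3)
      rw [u3, b3, ← Matrix.mul_assoc, a3, Matrix.zero_mul, Matrix.mul_zero]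
    · change _ * (_ * inc m k 4) = _ * (_ * inc m k 4)
      rw [u4, b4, a4, Matrix.mul_zero]
    · change _ * (_ * inc m k 5) = _ * (_ * inc m k 5)
      rw [u5, b5, ← Matrix.mul_assoc, a5, Matrix.mul_assoc, hA, ← Matrix.mul_assoc,
        ← Matrix.mul_assoc, u3]
    · change _ * (_ * inc m k 6) = _ * (_ * inc m k 6)
      rw [u6, b6, a6, ← Matrix.mul_assoc, u1]
    · change _ * (_ * inc m k 7) = _ * (_ * inc m k 7)
      rw [u7, b7, a7, ← Matrix.mul_assoc, u6]
    · change _ * (_ * inc m k 8) = _ * (_ * inc m k 8)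
      rw [u8, b8, ← Matrix.mul_assoc, a8, Matrix.mul_assoc, hT, ← Matrix.mul_assoc,
        ← Matrix.mul_assoc, u0]
  refine ⟨u, eq_conj_of_mat_mul ?_⟩
  have e₁ : mat (oneAdd (stabMat p w s A T) (stabMat_eq_zero p w s A T)) =
      1 + stabMat p w s A T := rfl
  have e₂ : mat (oneAdd (stabMat p w s D E) (stabMat_eq_zero p w s D E)) =
      1 + stabMat p w s D E := rfl
  rw [e₁, e₂, add_mul, mul_add, one_mul, mul_one, key]

variable {l₁ : Fin m → ℝ} {l₂ : Fin k → ℝ} {γ₃ : ℝ}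

theorem continuous_stabMat (p : Matrix (Fin (size m k 1)) (Fin (size m k 2)) ℝ)
    (w : Matrix (Fin (size m k 6)) (Fin (size m k 7)) ℝ)
    (s : Matrix (Fin (size m k 1)) (Fin (size m k 6)) ℝ) :
    Continuous fun AT : Matrix (Fin (size m k 3)) (Fin (size m k 5)) ℝ ×
      Matrix (Fin (size m k 0)) (Fin (size m k 8)) ℝ => stabMat p w s AT.1 AT.2 := by
  unfold stabMat
  fun_prop

/-- On the big cells, a block diagonal conjugation makes both free blocks antidiagonal without
touching `p`, `w`, `s`, and the result lies in the stabilizer. -/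
theorem conj_stabMat_mem_conjSaturation (hl₁ : ∀ r, l₁ r ≠ 0) (hl₂ : ∀ r, l₂ r ≠ 0)
    (hγ₁ : γ₁ ≠ 0) (hγ₂ : γ₂ ≠ 0) (p : Matrix (Fin (size m k 1)) (Fin (size m k 2)) ℝ)
    (w : Matrix (Fin (size m k 6)) (Fin (size m k 7)) ℝ)
    (s : Matrix (Fin (size m k 1)) (Fin (size m k 6)) ℝ)
    {A : Matrix (Fin (size m k 3)) (Fin (size m k 5)) ℝ}
    {T : Matrix (Fin (size m k 0)) (Fin (size m k 8)) ℝ} (hA : A ∈ bigCell k)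
    (hT : T ∈ bigCell m)
    (hpw : γ₁ * p (0 : Fin 1) (0 : Fin 1) = γ₂ * w (0 : Fin 1) (0 : Fin 1)) (h : UT (Idx m k)) :
    h * oneAdd (stabMat p w s A T) (stabMat_eq_zero p w s A T) * h⁻¹ ∈
      conjSaturation (coadStabilizer (fMat l₁ l₂ γ₁ γ₂ γ₃)) := by
  obtain ⟨U, V, D, hU, hV, hD, hAV⟩ := hA
  obtain ⟨U', V', D', hU', hV', hD', hTV⟩ := hT
  obtain ⟨u, hu⟩ := exists_conj_stabMat (m := m) (k := k) p w s hU hV hU' hV' hAV hTV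
  refine ⟨h * u, oneAdd (stabMat p w s D D') (stabMat_eq_zero p w s D D'), ?_, ?_⟩
  · rw [mem_coadStabilizer_fMat_iff hl₁ hl₂ hγ₁ hγ₂]
    have e : mat (oneAdd (stabMat p w s D D') (stabMat_eq_zero p w s D D')) - 1 =
      stabMat p w s D D' := mat_oneAdd_sub_one _ _
    rw [e]
    exact isStab_stabMat p w s D D' hD hD' hpw
  · rw [hu, mul_inv_rev]
    simp only [mul_assoc]

theorem mem_closure_bigCell_prod (A : Matrix (Fin (size m k 3)) (Fin (size m k 5)) ℝ)
    (T : Matrix (Fin (size m k 0)) (Fin (size m k 8)) ℝ) :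
    (A, T) ∈ closure {AT : Matrix (Fin (size m k 3)) (Fin (size m k 5)) ℝ ×
      Matrix (Fin (size m k 0)) (Fin (size m k 8)) ℝ | AT.1 ∈ bigCell k ∧ AT.2 ∈ bigCell m} :=
  ((dense_bigCell k).prod (dense_bigCell m)) (A, T)

/-- With `h`, `p`, `w`, `s` fixed, the conjugate depends continuously on `(A, T)`, and the pairs
from the big cells are dense. -/
theorem conj_stabMat_mem_closure (hl₁ : ∀ r, l₁ r ≠ 0) (hl₂ : ∀ r, l₂ r ≠ 0) (hγ₁ : γ₁ ≠ 0)
    (hγ₂ : γ₂ ≠ 0) (p : Matrix (Fin (size m k 1)) (Fin (size m k 2)) ℝ)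
    (w : Matrix (Fin (size m k 6)) (Fin (size m k 7)) ℝ)
    (s : Matrix (Fin (size m k 1)) (Fin (size m k 6)) ℝ)
    (A : Matrix (Fin (size m k 3)) (Fin (size m k 5)) ℝ)
    (T : Matrix (Fin (size m k 0)) (Fin (size m k 8)) ℝ)
    (hpw : γ₁ * p (0 : Fin 1) (0 : Fin 1) = γ₂ * w (0 : Fin 1) (0 : Fin 1)) (h : UT (Idx m k)) :
    h * oneAdd (stabMat p w s A T) (stabMat_eq_zero p w s A T) * h⁻¹ ∈
      closure (conjSaturation (coadStabilizer (fMat l₁ l₂ γ₁ γ₂ γ₃))) := by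
  let X : Matrix (Fin (size m k 3)) (Fin (size m k 5)) ℝ ×
      Matrix (Fin (size m k 0)) (Fin (size m k 8)) ℝ → UT (Idx m k) := fun AT =>
    oneAdd (stabMat p w s AT.1 AT.2) (stabMat_eq_zero p w s AT.1 AT.2)
  have hX : Continuous X := by
    rw [isInducing_mat.continuous_iff]
    have : Continuous fun AT : Matrix (Fin (size m k 3)) (Fin (size m k 5)) ℝ ×
        Matrix (Fin (size m k 0)) (Fin (size m k 8)) ℝ => 1 + stabMat p w s AT.1 AT.2 :=
      continuous_const.add (continuous_stabMat p w s)
    exact this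
  have hF : Continuous fun AT => h * X AT * h⁻¹ := (continuous_const.mul hX).mul continuous_const
  have hmem : ∀ AT ∈ {AT : Matrix (Fin (size m k 3)) (Fin (size m k 5)) ℝ ×
      Matrix (Fin (size m k 0)) (Fin (size m k 8)) ℝ | AT.1 ∈ bigCell k ∧ AT.2 ∈ bigCell m},
      h * X AT * h⁻¹ ∈ conjSaturation (coadStabilizer (fMat l₁ l₂ γ₁ γ₂ γ₃)) := fun AT hAT =>
    conj_stabMat_mem_conjSaturation hl₁ hl₂ hγ₁ hγ₂ p w s hAT.1 hAT.2 hpw h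
  have := map_mem_closure hF (mem_closure_bigCell_prod A T) hmem
  exact this

end Approximation

/-! ### Explicit reduction to the normal form. -/

section Intertwining

variable {m k : ℕ}

theorem mul_cancel_left {a b c : ℕ} {B : Matrix (Fin a) (Fin b) ℝ} {P : Matrix (Fin b) (Fin a) ℝ}
    (h : B * P = 1) (Z : Matrix (Fin a) (Fin c) ℝ) : B * (P * Z) = Z := by
  rw [← Matrix.mul_assoc, h, Matrix.one_mul]

/-- A matrix whose columns satisfy the relations that hold on the zero set of the ideal is
intertwined with `stabMat` by a unitriangular matrix. -/
theorem exists_intertwining {Y : Matrix (Idx m k) (Idx m k) ℝ}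
    {y02 : Matrix (Fin (size m k 0)) (Fin (size m k 2)) ℝ}
    {y12 : Matrix (Fin (size m k 1)) (Fin (size m k 2)) ℝ}
    {y13 : Matrix (Fin (size m k 1)) (Fin (size m k 3)) ℝ}
    {y14 : Matrix (Fin (size m k 1)) (Fin (size m k 4)) ℝ}
    {y05 : Matrix (Fin (size m k 0)) (Fin (size m k 5)) ℝ}
    {y15 : Matrix (Fin (size m k 1)) (Fin (size m k 5)) ℝ}
    {y25 : Matrix (Fin (size m k 2)) (Fin (size m k 5)) ℝ}
    {y35 : Matrix (Fin (size m k 3)) (Fin (size m k 5)) ℝ}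
    {y16 : Matrix (Fin (size m k 1)) (Fin (size m k 6)) ℝ}
    {y36 : Matrix (Fin (size m k 3)) (Fin (size m k 6)) ℝ}
    {y07 : Matrix (Fin (size m k 0)) (Fin (size m k 7)) ℝ}
    {y17 : Matrix (Fin (size m k 1)) (Fin (size m k 7)) ℝ}
    {y27 : Matrix (Fin (size m k 2)) (Fin (size m k 7)) ℝ}
    {y37 : Matrix (Fin (size m k 3)) (Fin (size m k 7)) ℝ}
    {y47 : Matrix (Fin (size m k 4)) (Fin (size m k 7)) ℝ}
    {y57 : Matrix (Fin (size m k 5)) (Fin (size m k 7)) ℝ}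
    {y67 : Matrix (Fin (size m k 6)) (Fin (size m k 7)) ℝ}
    {y08 : Matrix (Fin (size m k 0)) (Fin (size m k 8)) ℝ}
    {y18 : Matrix (Fin (size m k 1)) (Fin (size m k 8)) ℝ}
    {y38 : Matrix (Fin (size m k 3)) (Fin (size m k 8)) ℝ}
    {y68 : Matrix (Fin (size m k 6)) (Fin (size m k 8)) ℝ}
    {P : Matrix (Fin (size m k 2)) (Fin (size m k 1)) ℝ}
    {U : Matrix (Fin (size m k 5)) (Fin (size m k 3)) ℝ}
    {W : Matrix (Fin (size m k 7)) (Fin (size m k 6)) ℝ}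
    (hP₁ : y12 * P = (1 : Matrix (Fin (size m k 1)) (Fin (size m k 1)) ℝ))
    (hP₂ : P * y12 = (1 : Matrix (Fin (size m k 2)) (Fin (size m k 2)) ℝ))
    (hU₁ : y35 * U = (1 : Matrix (Fin (size m k 3)) (Fin (size m k 3)) ℝ))
    (hU₂ : U * y35 = (1 : Matrix (Fin (size m k 5)) (Fin (size m k 5)) ℝ))
    (hW₁ : y67 * W = (1 : Matrix (Fin (size m k 6)) (Fin (size m k 6)) ℝ))
    (hW₂ : W * y67 = (1 : Matrix (Fin (size m k 7)) (Fin (size m k 7)) ℝ))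
    (h13 : y13 = -(y12 * (y25 * U)))
    (h57 : y57 = -(U * (y36 * y67)))
    (c0 : Y * inc m k 0 = 0) (c1 : Y * inc m k 1 = 0)
    (c2 : Y * inc m k 2 = inc m k 0 * y02 + inc m k 1 * y12)
    (c3 : Y * inc m k 3 = inc m k 0 * (y02 * (P * y13)) + inc m k 1 * y13)
    (c4 : Y * inc m k 4 = inc m k 0 * (y02 * (P * y14)) + inc m k 1 * y14)
    (c5 : Y * inc m k 5 = inc m k 0 * y05 + inc m k 1 * y15 + inc m k 2 * y25 + inc m k 3 * y35)
    (c6 : Y * inc m k 6 = inc m k 0 * (y02 * (P * (y16 - y15 * (U * y36))) + y05 * (U * y36)) +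
      inc m k 1 * y16 + inc m k 2 * (y25 * (U * y36)) + inc m k 3 * y36)
    (c7 : Y * inc m k 7 = inc m k 0 * y07 + inc m k 1 * y17 + inc m k 2 * y27 + inc m k 3 * y37 +
      inc m k 4 * y47 + inc m k 5 * y57 + inc m k 6 * y67)
    (c8 : Y * inc m k 8 = inc m k 0 * y08 + inc m k 1 * y18 +
      inc m k 2 * (y25 * (U * (y38 - y37 * (W * y68))) + y27 * (W * y68)) + inc m k 3 * y38 +
      inc m k 4 * (y47 * (W * y68)) + inc m k 5 * (y57 * (W * y68)) + inc m k 6 * y68) :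
    ∃ (h : UT (Idx m k)) (s : Matrix (Fin (size m k 1)) (Fin (size m k 6)) ℝ)
      (T : Matrix (Fin (size m k 0)) (Fin (size m k 8)) ℝ),
      Y * mat h = mat h * stabMat y12 y67 s y35 T := by
  have cP₁ : ∀ {c : ℕ} (Z : Matrix (Fin (size m k 1)) (Fin c) ℝ), y12 * (P * Z) = Z :=
    mul_cancel_left hP₁
  have cP₂ : ∀ {c : ℕ} (Z : Matrix (Fin (size m k 2)) (Fin c) ℝ), P * (y12 * Z) = Z :=
    mul_cancel_left hP₂
  have cU₁ : ∀ {c : ℕ} (Z : Matrix (Fin (size m k 3)) (Fin c) ℝ), y35 * (U * Z) = Z :=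
    mul_cancel_left hU₁
  have cW₁ : ∀ {c : ℕ} (Z : Matrix (Fin (size m k 6)) (Fin c) ℝ), y67 * (W * Z) = Z :=
    mul_cancel_left hW₁
  -- Back substitution for the block column 8: subtracting `W y68` times column 7 clears rows 4, 5
  -- and 6, then `q` times column 5 clears rows 2 and 3, and `r` times column 2 clears row 1. Only
  -- row 0 remains.
  let q := U * (y38 - y37 * (W * y68))
  let r := P * (y18 - y17 * (W * y68) - y15 * q)
  -- Write `h = 1 + N`. Its columns 1, 3 and 6 are forced by the pivots: they are the images under
  -- `Y` of the columns 2, 5 and 7 of `h`, times the inverse pivots. Its columns 4, 5 and 8 are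
  -- corrected so that `Y` sends them to zero, to a multiple of column 3 and to block 0,
  -- respectively.
  let N : Matrix (Idx m k) (Idx m k) ℝ :=
    inc m k 0 * (y02 * P) * (inc m k 1)ᵀ +
    inc m k 0 * ((y05 - y02 * (P * y15)) * U) * (inc m k 3)ᵀ +
    inc m k 2 * (y25 * U) * (inc m k 3)ᵀ + inc m k 2 * (-(P * y14)) * (inc m k 4)ᵀ +
    inc m k 2 * (-(P * y15)) * (inc m k 5)ᵀ + inc m k 0 * (y07 * W) * (inc m k 6)ᵀ +
    inc m k 1 * (y17 * W) * (inc m k 6)ᵀ + inc m k 2 * (y27 * W) * (inc m k 6)ᵀ +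
    inc m k 3 * (y37 * W) * (inc m k 6)ᵀ + inc m k 4 * (y47 * W) * (inc m k 6)ᵀ +
    inc m k 5 * (y57 * W) * (inc m k 6)ᵀ + inc m k 7 * (-(W * y68)) * (inc m k 8)ᵀ +
    inc m k 5 * (-q) * (inc m k 8)ᵀ + inc m k 2 * (-r) * (inc m k 8)ᵀ
  have hN : ∀ x y, y ≤ x → N x y = 0 := by
    intro x y h
    simp only [N, Matrix.add_apply]
    rw [inc_mul_strict (by decide) _ x y h, inc_mul_strict (by decide) _ x y h,
      inc_mul_strict (by decide) _ x y h, inc_mul_strict (by decide) _ x y h,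
      inc_mul_strict (by decide) _ x y h, inc_mul_strict (by decide) _ x y h,
      inc_mul_strict (by decide) _ x y h, inc_mul_strict (by decide) _ x y h,
      inc_mul_strict (by decide) _ x y h, inc_mul_strict (by decide) _ x y h,
      inc_mul_strict (by decide) _ x y h, inc_mul_strict (by decide) _ x y h,
      inc_mul_strict (by decide) _ x y h, inc_mul_strict (by decide) _ x y h]
    simp
  have hm : mat (oneAdd N hN) = 1 + N := rfl
  have hH : mat (oneAdd N hN) * inc m k 0 = inc m k 0 ∧
    mat (oneAdd N hN) * inc m k 1 = inc m k 1 +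
      inc m k 0 * (y02 * P) ∧
    mat (oneAdd N hN) * inc m k 2 = inc m k 2 ∧
    mat (oneAdd N hN) * inc m k 3 = inc m k 3 +
      inc m k 0 * ((y05 - y02 * (P * y15)) * U) +
      inc m k 2 * (y25 * U) ∧
    mat (oneAdd N hN) * inc m k 4 = inc m k 4 +
      inc m k 2 * (-(P * y14)) ∧
    mat (oneAdd N hN) * inc m k 5 = inc m k 5 +
      inc m k 2 * (-(P * y15)) ∧
    mat (oneAdd N hN) * inc m k 6 = inc m k 6 +
      inc m k 0 * (y07 * W) +
      inc m k 1 * (y17 * W) +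
      inc m k 2 * (y27 * W) +
      inc m k 3 * (y37 * W) +
      inc m k 4 * (y47 * W) +
      inc m k 5 * (y57 * W) ∧
    mat (oneAdd N hN) * inc m k 7 = inc m k 7 ∧
    mat (oneAdd N hN) * inc m k 8 = inc m k 8 +
      inc m k 7 * (-(W * y68)) +
      inc m k 5 * (-q) +
      inc m k 2 * (-r) := by
    rw [hm]
    simp [N, Matrix.add_mul, Matrix.mul_assoc, transpose_inc_mul_inc_self,
      transpose_inc_mul_inc_of_ne, add_assoc]
  obtain ⟨u0, u1, u2, u3, u4, u5, u6, u7, u8⟩ := hH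
  -- This is the block (1,7) of `Y²` times the inverse `W` of `y67`. The matrix `T` is what remains
  -- of column 8 in row 0 after the elimination.
  let s := y16 + (y12 * y27 + y13 * y37 + y14 * y47 + y15 * y57) * W
  let T := y08 - y07 * (W * y68) - y05 * q - y02 * r
  refine ⟨oneAdd N hN, s, T, ext_of_mul_inc fun b => ?_⟩
  obtain ⟨b0, b1, b2, b3, b4, b5, b6, b7, b8⟩ := stabMat_mul_inc y12 y67 s y35 T
  have d : ∀ {b : Fin 9} {c : ℕ} {B : Matrix (Idx m k) (Fin (size m k b)) ℝ}
      (_ : Y * inc m k b = B) (Z : Matrix (Fin (size m k b)) (Fin c) ℝ),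
      Y * (inc m k b * Z) = B * Z := fun h Z => by rw [← Matrix.mul_assoc, h]
  rw [Matrix.mul_assoc, Matrix.mul_assoc]
  fin_cases b
  · change _ * (_ * inc m k 0) = _ * (_ * inc m k 0)
    rw [u0, b0, c0, Matrix.mul_zero]
  · change _ * (_ * inc m k 1) = _ * (_ * inc m k 1)
    rw [u1, b1, Matrix.mul_zero]
    simp only [Matrix.mul_add, Matrix.zero_mul, c1, d c0]
    abel
  · change _ * (_ * inc m k 2) = _ * (_ * inc m k 2)
    rw [u2, b2, ← Matrix.mul_assoc (mat _), u1]
    simp only [Matrix.add_mul, Matrix.mul_assoc, Matrix.mul_one, c2, hP₂]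
    abel
  · change _ * (_ * inc m k 3) = _ * (_ * inc m k 3)
    rw [u3, b3, Matrix.mul_zero]
    simp only [Matrix.mul_add, Matrix.mul_sub, Matrix.mul_neg, Matrix.add_mul, Matrix.sub_mul,
      Matrix.mul_assoc, Matrix.zero_mul, c3, d c0, d c2, cP₂, h13]
    abel
  · change _ * (_ * inc m k 4) = _ * (_ * inc m k 4)
    rw [u4, b4, Matrix.mul_zero]
    simp only [Matrix.mul_add, Matrix.mul_neg, Matrix.add_mul, Matrix.mul_assoc, c4, d c2, cP₁]
    abel
  · change _ * (_ * inc m k 5) = _ * (_ * inc m k 5)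
    rw [u5, b5, ← Matrix.mul_assoc (mat _), u3]
    simp only [Matrix.mul_add, Matrix.mul_sub, Matrix.mul_neg, Matrix.add_mul, Matrix.sub_mul,
      Matrix.mul_assoc, Matrix.mul_one, c5, d c2, cP₁, hU₂]
    abel
  -- Here `h57` gives `y57 W = -U y36`, so the contribution of column 5 cancels rows 2 and 3 of
  -- column 6; the rest is column 1 of `h` times `s`.
  · change _ * (_ * inc m k 6) = _ * (_ * inc m k 6)
    rw [u6, b6, ← Matrix.mul_assoc (mat _), u1]
    simp only [Matrix.mul_add, Matrix.mul_sub, Matrix.mul_neg, Matrix.neg_mul, Matrix.add_mul,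
      Matrix.mul_assoc, Matrix.mul_one, Matrix.zero_mul, c6, d c0, d c1, d c2, d c3, d c4, d c5,
      cP₂, cU₁, hW₁, h13, h57, s]
    abel
  · change _ * (_ * inc m k 7) = _ * (_ * inc m k 7)
    rw [u7, b7, ← Matrix.mul_assoc (mat _), u6]
    simp only [Matrix.mul_neg, Matrix.neg_mul, Matrix.add_mul, Matrix.mul_assoc, Matrix.mul_one,
      c7, hW₁, hW₂, h57]
    abel
  · change _ * (_ * inc m k 8) = _ * (_ * inc m k 8)
    rw [u8, b8, ← Matrix.mul_assoc (mat _), u0]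
    simp only [Matrix.mul_add, Matrix.mul_sub, Matrix.mul_neg, Matrix.neg_mul, Matrix.add_mul,
      Matrix.mul_assoc, c8, d c7, d c5, d c2, cP₁, cU₁, cW₁, h57, T, r, q]
    abel

end Intertwining

/-! ### Zeros of the ideal are conjugate to the normal form. -/

section ZeroSet

variable {m k : ℕ} {γ₁ γ₂ : ℝ}

/-- Extending the solution by zero to the pivots outside `Φ(c)` allows all marked blocks to be
treated with the same three summands. -/
theorem sum_minorIdx {i j : Fin 9}
    (X : ∀ s : Fin 3, Matrix (Fin (size m k (colBlk s))) (Fin (size m k j)) ℝ)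
    (hX : ∀ s, ¬(i < rowBlk s ∧ colBlk s < j) → X s = 0) (F : Idx m k → ℝ)
    (q : Fin (size m k j)) :
    ∑ y : MinorIdx m k i j, F (minorCol y) * X y.1.1 (Fin.cast (size_rowBlk m k y.1.1) y.2) q =
      ∑ s, ∑ c, F (pos (colBlk s) c) * X s c q := by
  rw [Fintype.sum_sigma]
  refine Fintype.sum_of_injective (fun s : PhiOf i j => s.1) Subtype.val_injective _ _
    (fun s hs => ?_) fun s => ?_
  · have h0 : X s = 0 := hX s fun h => hs ⟨⟨s, h⟩, rfl⟩
    refine Finset.sum_eq_zero fun c _ => ?_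
    rw [h0, Matrix.zero_apply, mul_zero]
  · exact Fintype.sum_equiv (finCongr (size_rowBlk m k s.1)) _ _ fun c => rfl

/-- At a zero of a bordered minor, the solution of the linear system given by the inner minor
expresses the entry of the block as well. -/
theorem blk_eq_sum_of_bordered {Y : Matrix (Idx m k) (Idx m k) ℝ} {i j : Fin 9}
    (hA : (Y.submatrix (minorRow (i := i) (j := j)) minorCol).det ≠ 0)
    (hM : ∀ r q, (Y.submatrix (Sum.elim (minorRow (i := i) (j := j)) fun _ : Unit => pos i r)
      (Sum.elim (minorCol (i := i) (j := j)) fun _ : Unit => pos j q)).det = 0)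
    (X : ∀ s : Fin 3, Matrix (Fin (size m k (colBlk s))) (Fin (size m k j)) ℝ)
    (hX : ∀ s, ¬(i < rowBlk s ∧ colBlk s < j) → X s = 0)
    (hs : ∀ s, (i < rowBlk s ∧ colBlk s < j) →
      ∑ t, blk Y (rowBlk s) (colBlk t) * X t = blk Y (rowBlk s) j) :
    blk Y i j = ∑ t, blk Y i (colBlk t) * X t := by
  ext r q
  -- A linear relation between the rows of the singular bordered matrix.
  obtain ⟨u, hu0, hu⟩ := Matrix.exists_vecMul_eq_zero_iff.2 (hM r q)
  have hrow : ∀ a : Fin 9, ∀ c, (∑ t, blk Y a (colBlk t) * X t) c q =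
      ∑ y : MinorIdx m k i j, Y (pos a c) (minorCol y) *
        X y.1.1 (Fin.cast (size_rowBlk m k y.1.1) y.2) q := by
    intro a c
    rw [sum_minorIdx X hX (Y (pos a c)) q, Matrix.sum_apply]
    rfl
  have hcol : ∀ v, ∑ x, u (Sum.inl x) * Y (minorRow x)
      (Sum.elim (minorCol (i := i) (j := j)) (fun _ : Unit => pos j q) v) +
      u (Sum.inr ()) * Y (pos i r)
        (Sum.elim (minorCol (i := i) (j := j)) (fun _ : Unit => pos j q) v) = 0 := by
    intro v
    have := congrFun hu v
    simpa [Matrix.vecMul, dotProduct, Fintype.sum_sum_type] using this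
  -- The added row occurs in the relation, since the rows of the invertible inner minor are
  -- independent. Hence that row satisfies the linear system solved by `X`.
  have hne : u (Sum.inr ()) ≠ 0 := by
    intro h0
    refine hu0 ?_
    have hv : Matrix.vecMul (fun x => u (Sum.inl x))
        (Y.submatrix (minorRow (i := i) (j := j)) (minorCol (i := i) (j := j))) = 0 := by
      ext v
      have := hcol (Sum.inl v)
      rw [h0, zero_mul, add_zero] at this
      exact this
    have hz : (fun x => u (Sum.inl x)) = 0 := by
      by_contra hne
      exact hA (Matrix.exists_vecMul_eq_zero_iff.1 ⟨_, hne, hv⟩)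
    ext x
    rcases x with x | x
    · exact congrFun hz x
    · exact h0
  refine mul_left_cancel₀ hne ?_
  have h₁ := hcol (Sum.inr ())
  have h₂ : ∑ y : MinorIdx m k i j, (∑ x, u (Sum.inl x) * Y (minorRow x) (minorCol y) +
      u (Sum.inr ()) * Y (pos i r) (minorCol y)) *
        X y.1.1 (Fin.cast (size_rowBlk m k y.1.1) y.2) q = 0 :=
    Finset.sum_eq_zero fun y _ => by
      have := hcol (Sum.inl y)
      simp only [Sum.elim_inl] at this
      rw [this, zero_mul]
  have h₃ : ∀ x : MinorIdx m k i j, Y (minorRow x) (pos j q) =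
      ∑ y : MinorIdx m k i j, Y (minorRow x) (minorCol y) *
        X y.1.1 (Fin.cast (size_rowBlk m k y.1.1) y.2) q := by
    intro x
    have := congrFun (congrFun (hs x.1.1 x.1.2) x.2) q
    rw [hrow] at this
    exact this.symm
  rw [hrow, blk_apply, Finset.mul_sum]
  simp only [Sum.elim_inr, h₃] at h₁
  simp only [add_mul, Finset.sum_add_distrib, Finset.sum_mul, mul_assoc] at h₂
  rw [Finset.sum_comm] at h₂
  simp only [← Finset.mul_sum] at h₂
  rw [← Finset.mul_sum]
  linarith

/-- The vanishing Schur complement in usable form: for any solution of the linear system on the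
pivot rows of `Φ(c)`, row block `i` obeys the same equation. The system is block triangular, so
solutions come from back substitution without inverting the whole minor. -/
theorem bullet_relation {g : UT (Idx m k)} (hd : evalAt g (d₁ m k) ≠ 0)
    (hg : ∀ i j, (i, j) ∈ bullets → ∀ r q, evalAt g (ΔTilde m k i j r q) = 0) {i j : Fin 9}
    (hij : (i, j) ∈ bullets)
    (X₀ : Matrix (Fin (size m k 2)) (Fin (size m k j)) ℝ)
    (X₁ : Matrix (Fin (size m k 5)) (Fin (size m k j)) ℝ)
    (X₂ : Matrix (Fin (size m k 7)) (Fin (size m k j)) ℝ)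
    (h₀ : ¬(i < 1 ∧ 2 < j) → X₀ = 0) (h₁ : ¬(i < 3 ∧ 5 < j) → X₁ = 0)
    (h₂ : ¬(i < 6 ∧ 7 < j) → X₂ = 0)
    (e₀ : (i < 1 ∧ 2 < j) → blk (mat g - 1) 1 2 * X₀ + blk (mat g - 1) 1 5 * X₁ +
      blk (mat g - 1) 1 7 * X₂ = blk (mat g - 1) 1 j)
    (e₁ : (i < 3 ∧ 5 < j) → blk (mat g - 1) 3 5 * X₁ +
      blk (mat g - 1) 3 7 * X₂ = blk (mat g - 1) 3 j)
    (e₂ : (i < 6 ∧ 7 < j) → blk (mat g - 1) 6 7 * X₂ = blk (mat g - 1) 6 j) :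
    blk (mat g - 1) i j = blk (mat g - 1) i 2 * X₀ + blk (mat g - 1) i 5 * X₁ +
      blk (mat g - 1) i 7 * X₂ := by
  have hA : ((mat g - 1).submatrix (minorRow (i := i) (j := j)) minorCol).det ≠ 0 := by
    rw [submatrix_sub_one_of_ne (mat g) (minorRow (i := i) (j := j)) (minorCol (i := i) (j := j))
        fun u v => ne_of_blkOf_ne (rowBlk_ne_colBlk u.1.1 v.1.1),
      ← evalAt_Δ, Δ_eq_prod, map_prod]
    refine Finset.prod_ne_zero_iff.2 fun s _ => ?_
    rw [evalAt_pivot_det]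
    exact (evalAt_d₁_ne_zero_iff g).1 hd s.1
  have hz : ∀ a b : Fin 9, b < a → blk (mat g - 1) a b = 0 := fun a b hab => by
    rw [blk_sub_one _ hab.ne']
    exact (isUpper_mat g).blk_eq_zero hab
  have e₁' : (i < 3 ∧ 5 < j) → blk (mat g - 1) 3 2 * X₀ + blk (mat g - 1) 3 5 * X₁ +
      blk (mat g - 1) 3 7 * X₂ = blk (mat g - 1) 3 j := fun h => by
    rw [hz 3 2 (by decide), Matrix.zero_mul, zero_add, e₁ h]
  have e₂' : (i < 6 ∧ 7 < j) → blk (mat g - 1) 6 2 * X₀ + blk (mat g - 1) 6 5 * X₁ +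
      blk (mat g - 1) 6 7 * X₂ = blk (mat g - 1) 6 j := fun h => by
    rw [hz 6 2 (by decide), hz 6 5 (by decide), Matrix.zero_mul, Matrix.zero_mul, zero_add,
      zero_add, e₂ h]
  let X : ∀ s : Fin 3, Matrix (Fin (size m k (colBlk s))) (Fin (size m k j)) ℝ := fun s =>
    match s with
    | 0 => X₀
    | 1 => X₁
    | 2 => X₂
  have key := blk_eq_sum_of_bordered hA (fun r q => by
    rw [← evalAt_ΔTilde_sub_one g hij]; exact hg i j hij r q) X ?_ ?_
  · rw [key, Fin.sum_univ_three]
    rfl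
  · intro s
    fin_cases s
    exacts [h₀, h₁, h₂]
  · intro s hs
    rw [Fin.sum_univ_three]
    fin_cases s
    · exact e₀ hs
    · exact e₁' hs
    · exact e₂' hs

theorem exists_inverse_of_det_cast_ne_zero {a b : ℕ} (h : a = b)
    (B : Matrix (Fin a) (Fin b) ℝ) (hB : (B.submatrix id (Fin.cast h)).det ≠ 0) :
    ∃ P : Matrix (Fin b) (Fin a) ℝ, B * P = 1 ∧ P * B = 1 := by
  subst h
  have hu : IsUnit B.det := isUnit_iff_ne_zero.2 hB
  exact ⟨B⁻¹, Matrix.mul_nonsing_inv B hu, Matrix.nonsing_inv_mul B hu⟩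

theorem exists_pivot_inverse {g : UT (Idx m k)} (hd : evalAt g (d₁ m k) ≠ 0) (s : Fin 3) :
    ∃ P : Matrix (Fin (size m k (colBlk s))) (Fin (size m k (rowBlk s))) ℝ,
      blk (mat g - 1) (rowBlk s) (colBlk s) * P = 1 ∧
      P * blk (mat g - 1) (rowBlk s) (colBlk s) = 1 := by
  rw [blk_sub_one _ (rowBlk_ne_colBlk s s)]
  exact exists_inverse_of_det_cast_ne_zero (size_rowBlk m k s) _
    ((evalAt_d₁_ne_zero_iff g).1 hd s)

theorem blk_diag_eq_zero {g : UT (Idx m k)} {b : Fin 9}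
    (h : ∀ r q : Fin (size m k b), r < q → mat g (pos b r) (pos b q) = 0) :
    blk (mat g - 1) b b = 0 := by
  ext r q
  rw [blk_apply, Matrix.sub_apply, Matrix.zero_apply]
  rcases lt_trichotomy r q with hrq | rfl | hrq
  · rw [h r q hrq, Matrix.one_apply_ne (pos_lt_pos.2 hrq).ne, sub_zero]
  · rw [mat_diag, Matrix.one_apply_eq, sub_self]
  · rw [mat_lower g (pos_lt_pos.2 hrq), Matrix.one_apply_ne (pos_lt_pos.2 hrq).ne', sub_zero]

theorem blk_diag_eq_zero_of_subsingleton {g : UT (Idx m k)} {b : Fin 9}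
    (hb : Subsingleton (Fin (size m k b))) : blk (mat g - 1) b b = 0 :=
  blk_diag_eq_zero fun r q h => absurd (Subsingleton.elim r q) h.ne

set_option maxHeartbeats 1000000 in
/-- Every zero of the ideal is conjugate to a matrix `1 + stabMat`. -/
theorem exists_conj_of_mem_zeroSet {g : UT (Idx m k)}
    (hg : g ∈ zeroSet (d₁ m k) (I' m k γ₁ γ₂)) : ∃ (h : UT (Idx m k))
      (p : Matrix (Fin (size m k 1)) (Fin (size m k 2)) ℝ)
      (w : Matrix (Fin (size m k 6)) (Fin (size m k 7)) ℝ)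
      (s : Matrix (Fin (size m k 1)) (Fin (size m k 6)) ℝ)
      (A : Matrix (Fin (size m k 3)) (Fin (size m k 5)) ℝ)
      (T : Matrix (Fin (size m k 0)) (Fin (size m k 8)) ℝ),
      γ₁ * p (0 : Fin 1) (0 : Fin 1) = γ₂ * w (0 : Fin 1) (0 : Fin 1) ∧
      g = h * oneAdd (stabMat p w s A T) (stabMat_eq_zero p w s A T) * h⁻¹ := by
  obtain ⟨hd, hS₀, hS₁, hS₂⟩ := (mem_zeroSet_iff γ₁ γ₂ g).1 hg
  have hlow : ∀ a b : Fin 9, decide (b < a) = true → blk (mat g - 1) a b = 0 := fun a b hab => by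
    rw [blk_sub_one _ (of_decide_eq_true hab).ne']
    exact (isUpper_mat g).blk_eq_zero (of_decide_eq_true hab)
  have hdiag : ∀ b ∈ ({0, 3, 5, 8} : Set (Fin 9)), blk (mat g - 1) b b = 0 := fun b hb =>
    blk_diag_eq_zero fun r q hrq => by
      rw [← evalAt_block]
      exact hS₀ _ ⟨b, hb, r, q, hrq, rfl⟩
  have z00 := hdiag 0 (by simp)
  have z33 := hdiag 3 (by simp)
  have z55 := hdiag 5 (by simp)
  have z88 := hdiag 8 (by simp)
  have z11 : blk (mat g - 1) 1 1 = 0 :=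
    blk_diag_eq_zero_of_subsingleton (inferInstanceAs (Subsingleton (Fin 1)))
  have z22 : blk (mat g - 1) 2 2 = 0 :=
    blk_diag_eq_zero_of_subsingleton (inferInstanceAs (Subsingleton (Fin 1)))
  have z44 : blk (mat g - 1) 4 4 = 0 :=
    blk_diag_eq_zero_of_subsingleton (inferInstanceAs (Subsingleton (Fin 1)))
  have z66 : blk (mat g - 1) 6 6 = 0 :=
    blk_diag_eq_zero_of_subsingleton (inferInstanceAs (Subsingleton (Fin 1)))
  have z77 : blk (mat g - 1) 7 7 = 0 :=
    blk_diag_eq_zero_of_subsingleton (inferInstanceAs (Subsingleton (Fin 1)))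
  obtain ⟨p, hp₁, hp₂⟩ : ∃ P : Matrix (Fin (size m k 2)) (Fin (size m k 1)) ℝ,
    blk (mat g - 1) 1 2 * P = (1 : Matrix (Fin (size m k 1)) (Fin (size m k 1)) ℝ) ∧
      P * blk (mat g - 1) 1 2 = (1 : Matrix (Fin (size m k 2)) (Fin (size m k 2)) ℝ) :=
    exists_pivot_inverse hd 0
  obtain ⟨u, hu₁, hu₂⟩ : ∃ P : Matrix (Fin (size m k 5)) (Fin (size m k 3)) ℝ,
    blk (mat g - 1) 3 5 * P = (1 : Matrix (Fin (size m k 3)) (Fin (size m k 3)) ℝ) ∧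
      P * blk (mat g - 1) 3 5 = (1 : Matrix (Fin (size m k 5)) (Fin (size m k 5)) ℝ) :=
    exists_pivot_inverse hd 1
  obtain ⟨w, hw₁, hw₂⟩ : ∃ P : Matrix (Fin (size m k 7)) (Fin (size m k 6)) ℝ,
    blk (mat g - 1) 6 7 * P = (1 : Matrix (Fin (size m k 6)) (Fin (size m k 6)) ℝ) ∧
      P * blk (mat g - 1) 6 7 = (1 : Matrix (Fin (size m k 7)) (Fin (size m k 7)) ℝ) :=
    exists_pivot_inverse hd 2
  have cp₁ : ∀ {b : Fin 9} (Z : Matrix (Fin (size m k 1)) (Fin (size m k b)) ℝ),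
      blk (mat g - 1) 1 2 * (p * Z) = Z := fun Z =>
    mul_cancel_left hp₁ Z
  have cp₂ : ∀ {b : Fin 9} (Z : Matrix (Fin (size m k 2)) (Fin (size m k b)) ℝ),
      p * (blk (mat g - 1) 1 2 * Z) = Z := fun Z =>
    mul_cancel_left hp₂ Z
  have cu₁ : ∀ {b : Fin 9} (Z : Matrix (Fin (size m k 3)) (Fin (size m k b)) ℝ),
      blk (mat g - 1) 3 5 * (u * Z) = Z := fun Z =>
    mul_cancel_left hu₁ Z
  have cu₂ : ∀ {b : Fin 9} (Z : Matrix (Fin (size m k 5)) (Fin (size m k b)) ℝ),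
      u * (blk (mat g - 1) 3 5 * Z) = Z := fun Z =>
    mul_cancel_left hu₂ Z
  have cw₁ : ∀ {b : Fin 9} (Z : Matrix (Fin (size m k 6)) (Fin (size m k b)) ℝ),
      blk (mat g - 1) 6 7 * (w * Z) = Z := fun Z =>
    mul_cancel_left hw₁ Z
  -- For `Φ(c)` empty the bordered minor is the entry itself, so the block vanishes.
  have zero : ∀ i j, (i, j) ∈ bullets → (i < 1 ∧ 2 < j → False) → (i < 3 ∧ 5 < j → False) →
      (i < 6 ∧ 7 < j → False) → blk (mat g - 1) i j = 0 := by
    intro i j hij h₀ h₁ h₂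
    have := bullet_relation hd hS₁ hij 0 0 0 (fun _ => rfl) (fun _ => rfl) (fun _ => rfl)
      (fun h => (h₀ h).elim) (fun h => (h₁ h).elim) (fun h => (h₂ h).elim)
    simpa using this
  have z01 := zero 0 1 (by simp [bullets]) (by decide) (by decide) (by decide)
  have z23 := zero 2 3 (by simp [bullets]) (by decide) (by decide) (by decide)
  have z24 := zero 2 4 (by simp [bullets]) (by decide) (by decide) (by decide)
  have z34 := zero 3 4 (by simp [bullets]) (by decide) (by decide) (by decide)
  have z45 := zero 4 5 (by simp [bullets]) (by decide) (by decide) (by decide)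
  have z46 := zero 4 6 (by simp [bullets]) (by decide) (by decide) (by decide)
  have z56 := zero 5 6 (by simp [bullets]) (by decide) (by decide) (by decide)
  have z78 := zero 7 8 (by simp [bullets]) (by decide) (by decide) (by decide)
  -- For the seven other marked blocks, the explicit coefficients solve the pivot system from the
  -- last pivot upwards, with zero for each pivot not in `Φ(c)`.
  have r03 := bullet_relation hd hS₁ (i := 0) (j := 3) (by simp [bullets])
    (p * blk (mat g - 1) 1 3) 0 0 (fun h => absurd (by decide) h) (fun _ => rfl) (fun _ => rfl)
    (fun _ => by simp [cp₁]) (fun h => absurd h (by decide)) (fun h => absurd h (by decide))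
  have r04 := bullet_relation hd hS₁ (i := 0) (j := 4) (by simp [bullets])
    (p * blk (mat g - 1) 1 4) 0 0 (fun h => absurd (by decide) h) (fun _ => rfl) (fun _ => rfl)
    (fun _ => by simp [cp₁]) (fun h => absurd h (by decide)) (fun h => absurd h (by decide))
  have r06 := bullet_relation hd hS₁ (i := 0) (j := 6) (by simp [bullets])
    (p * (blk (mat g - 1) 1 6 - blk (mat g - 1) 1 5 * (u * blk (mat g - 1) 3 6)))
    (u * blk (mat g - 1) 3 6) 0
    (fun h => absurd (by decide) h) (fun h => absurd (by decide) h) (fun _ => rfl)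
    (fun _ => by simp [cp₁]) (fun _ => by simp [cu₁]) (fun h => absurd h (by decide))
  have r26 := bullet_relation hd hS₁ (i := 2) (j := 6) (by simp [bullets])
    0 (u * blk (mat g - 1) 3 6) 0
    (fun _ => rfl) (fun h => absurd (by decide) h) (fun _ => rfl)
    (fun h => absurd h (by decide)) (fun _ => by simp [cu₁]) (fun h => absurd h (by decide))
  have r28 := bullet_relation hd hS₁ (i := 2) (j := 8) (by simp [bullets])
    0 (u * (blk (mat g - 1) 3 8 - blk (mat g - 1) 3 7 * (w * blk (mat g - 1) 6 8)))
    (w * blk (mat g - 1) 6 8)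
    (fun _ => rfl) (fun h => absurd (by decide) h) (fun h => absurd (by decide) h)
    (fun h => absurd h (by decide)) (fun _ => by simp [cu₁]) (fun _ => by simp [cw₁])
  have r48 := bullet_relation hd hS₁ (i := 4) (j := 8) (by simp [bullets])
    0 0 (w * blk (mat g - 1) 6 8)
    (fun _ => rfl) (fun _ => rfl) (fun h => absurd (by decide) h)
    (fun h => absurd h (by decide)) (fun h => absurd h (by decide)) (fun _ => by simp [cw₁])
  have r58 := bullet_relation hd hS₁ (i := 5) (j := 8) (by simp [bullets])
    0 0 (w * blk (mat g - 1) 6 8)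
    (fun _ => rfl) (fun _ => rfl) (fun h => absurd (by decide) h)
    (fun h => absurd h (by decide)) (fun h => absurd h (by decide)) (fun _ => by simp [cw₁])
  have q15 : blk (mat g - 1) 1 2 * blk (mat g - 1) 2 5 +
      blk (mat g - 1) 1 3 * blk (mat g - 1) 3 5 = 0 := by
    ext r q
    have := hS₂ _ (Or.inl (Or.inl ⟨r, q, rfl⟩))
    rw [Matrix.add_apply, map_add, evalAt_block_mul, evalAt_block_mul] at this
    rw [blk_sub_one _ (by decide), blk_sub_one _ (by decide), blk_sub_one _ (by decide),
      blk_sub_one _ (by decide)]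
    exact this
  have q37 : blk (mat g - 1) 3 5 * blk (mat g - 1) 5 7 +
      blk (mat g - 1) 3 6 * blk (mat g - 1) 6 7 = 0 := by
    ext r q
    have := hS₂ _ (Or.inl (Or.inr ⟨r, q, rfl⟩))
    rw [Matrix.add_apply, map_add, evalAt_block_mul, evalAt_block_mul] at this
    rw [blk_sub_one _ (by decide), blk_sub_one _ (by decide), blk_sub_one _ (by decide),
      blk_sub_one _ (by decide)]
    exact this
  have hγ : γ₁ * blk (mat g - 1) 1 2 (0 : Fin 1) (0 : Fin 1) =
      γ₂ * blk (mat g - 1) 6 7 (0 : Fin 1) (0 : Fin 1) := by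
    have := hS₂ _ (Or.inr rfl)
    have c₁ : evalAt g (C m k 1 2 (0 : Fin 1) (0 : Fin 1)) =
        blk (mat g) 1 2 (0 : Fin 1) (0 : Fin 1) := evalAt_genericMat g _ _
    have c₂ : evalAt g (C m k 6 7 (0 : Fin 1) (0 : Fin 1)) =
        blk (mat g) 6 7 (0 : Fin 1) (0 : Fin 1) := evalAt_genericMat g _ _
    rw [map_sub, map_mul, map_mul, evalAt_C, evalAt_C, c₁, c₂, sub_eq_zero] at this
    rw [blk_sub_one _ (by decide), blk_sub_one _ (by decide)]
    exact this
  -- The quadratic equations are solved for the blocks (1,3) and (5,7) by cancelling the invertible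
  -- pivot in (3,5).
  have e13 : blk (mat g - 1) 1 3 = -(blk (mat g - 1) 1 2 * (blk (mat g - 1) 2 5 * u)) := by
    have h := congrArg (fun Z => Z * u) q15
    simp only [Matrix.add_mul, Matrix.zero_mul, Matrix.mul_assoc, hu₁, Matrix.mul_one] at h
    exact eq_neg_of_add_eq_zero_right h
  have e57 : blk (mat g - 1) 5 7 = -(u * (blk (mat g - 1) 3 6 * blk (mat g - 1) 6 7)) := by
    have h := congrArg (fun Z => u * Z) q37
    simp only [Matrix.mul_add, Matrix.mul_zero, cu₂] at h
    exact eq_neg_of_add_eq_zero_left h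
  have c : ∀ b, (mat g - 1) * inc m k b = ∑ a, inc m k a * blk (mat g - 1) a b :=
    mul_inc_eq_sum (mat g - 1)
  simp only [Matrix.mul_zero, add_zero, zero_add] at r03 r04 r06 r26 r28 r48 r58
  obtain ⟨h, s, T, key⟩ := exists_intertwining
    (y02 := blk (mat g - 1) 0 2) (y14 := blk (mat g - 1) 1 4) (y05 := blk (mat g - 1) 0 5)
    (y15 := blk (mat g - 1) 1 5) (y16 := blk (mat g - 1) 1 6) (y07 := blk (mat g - 1) 0 7)
    (y17 := blk (mat g - 1) 1 7) (y27 := blk (mat g - 1) 2 7) (y37 := blk (mat g - 1) 3 7)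
    (y47 := blk (mat g - 1) 4 7) (y08 := blk (mat g - 1) 0 8) (y18 := blk (mat g - 1) 1 8)
    (y38 := blk (mat g - 1) 3 8) (y68 := blk (mat g - 1) 6 8)
    hp₁ hp₂ hu₁ hu₂ hw₁ hw₂ e13 e57
    (by rw [c, sum_fin_nine]; simp [hlow, z00])
    (by rw [c, sum_fin_nine]; simp [hlow, z01, z11])
    (by rw [c, sum_fin_nine]; simp [hlow, z22])
    (by rw [c, sum_fin_nine]; simp [hlow, z23, z33, ← r03])
    (by rw [c, sum_fin_nine]; simp [hlow, z24, z34, z44, ← r04])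
    (by rw [c, sum_fin_nine]; simp [hlow, z45, z55])
    (by rw [c, sum_fin_nine]; simp [hlow, z46, z56, z66, ← r06, ← r26])
    (by rw [c, sum_fin_nine]; simp [hlow, z77])
    (by rw [c, sum_fin_nine]; simp [z78, z88, ← r28, ← r48, ← r58])
  refine ⟨h, _, _, s, blk (mat g - 1) 3 5, T, hγ, eq_conj_of_mat_mul ?_⟩
  have e : mat (oneAdd (stabMat (blk (mat g - 1) 1 2) (blk (mat g - 1) 6 7) s
      (blk (mat g - 1) 3 5) T) (stabMat_eq_zero _ _ s _ T)) =
      1 + stabMat (blk (mat g - 1) 1 2) (blk (mat g - 1) 6 7) s (blk (mat g - 1) 3 5) T := rfl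
  rw [e, mul_add, mul_one, ← key, sub_mul, one_mul]
  abel

end ZeroSet

end Subregular

end

/-! ### The two inclusions combined. -/

theorem proposition8 (m k : ℕ) (l₁ : Fin m → ℝ) (l₂ : Fin k → ℝ) (γ₁ γ₂ γ₃ : ℝ)
    (hl₁ : ∀ r, l₁ r ≠ 0) (hl₂ : ∀ r, l₂ r ≠ 0) (hγ₁ : γ₁ ≠ 0) (hγ₂ : γ₂ ≠ 0) :
    closure (Subregular.zeroSet (Subregular.d₁ m k) (Subregular.I' m k γ₁ γ₂)) =
      closure (Subregular.conjSaturation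
        (Subregular.coadStabilizer (Subregular.fMat l₁ l₂ γ₁ γ₂ γ₃))) := by
  refine Set.Subset.antisymm (closure_minimal ?_ isClosed_closure)
    (closure_minimal ?_ isClosed_closure)
  · intro g hg
    obtain ⟨h, p, w, s, A, T, hpw, rfl⟩ := Subregular.exists_conj_of_mem_zeroSet hg
    exact Subregular.conj_stabMat_mem_closure hl₁ hl₂ hγ₁ hγ₂ p w s A T hpw h
  · rintro _ ⟨h, x, hx, rfl⟩
    exact Subregular.conj_stab_mem_closure_zeroSet hγ₁ hγ₂
      ((Subregular.mem_coadStabilizer_fMat_iff hl₁ hl₂ hγ₁ hγ₂ x).1 hx)
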